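/- Let $0<d<\pi/2$ and $\mathscr{D}_d=\{\zeta\in\mathbb{C}:|\operatorname{Im}\zeta|<d\}$. Put $\psi_2(\zeta)=\mathrm{e}^{\zeta}$ and $\psi_3(\zeta)=\operatorname{arcsinh}(\mathrm{e}^{\zeta})$ (principal branch), and let $\psi_i^{-1}:(0,\infty)\to\mathbb{R}$ be the inverse of the restriction of $\psi_i$ to $\mathbb{R}$. For $\alpha,\beta>0$ let (principal branches) $$E_2(z;\alpha,\beta)=\frac{z^{\alpha-1}}{(1+z^2)^{(\alpha+\beta)/2}},\qquad E_3(z;\alpha,\beta)=\left(\frac{z}{1+z}\right)^{\alpha-1}\mathrm{e}^{-\beta z},$$ and let $$J(k,h)(x)=h\left\{\frac12+\frac1\pi\operatorname{Si}\bigl[\pi(x/h-k)\bigr]\right\},\qquad \operatorname{Si}(x)=\int_0^x\frac{\sin\sigma}{\sigma}\,d\sigma .$$ **Theorem.** The following is true for $i=2$ and $i=3$. Assume that $f$ is analytic in $\psi_i(\mathscr{D}_d)$, and that there are positive constants $K$, $\alpha$, $\beta$ such that $|f(z)|\le K|E_i(z;\alpha,\beta)|$ for all $z\in\psi_i(\mathscr{D}_d)$.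 Let $\mu=\min\{\alpha,\beta\}$, let $n$ be a positive integer, let $h=\sqrt{\pi d/(\mu n)}$, and let $$\begin{cases} M=n,\quad N=\lceil\alpha n/\beta\rceil & (\text{if }\mu=\alpha),\\ N=n,\quad M=\lceil\beta n/\alpha\rceil & (\text{if }\mu=\beta).\end{cases}$$ Then $f$ is integrable on $(0,\tau)$ for every $\tau>0$, and $$\sup_{\tau\in(0,\infty)}\left|\int_0^{\tau}f(t)\,dt-\sum_{k=-M}^{N}f(\psi_i(kh))\,\psi_i'(kh)\,J(k,h)(\psi_i^{-1}(\tau))\right|\le C_i\,\mathrm{e}^{-\sqrt{\pi d\mu n}},$$ where $C_2$ and $C_3$ are the constants, independent of $n$, $$C_2=\frac{2K}{\mu}\left\{\frac{1}{(1-\mathrm{e}^{-2\sqrt{\pi d\mu}})\{\cos d\}^{(\alpha+\beta)/2}}\sqrt{\frac{\pi}{d\mu}}+1.1\right\},$$ $$C_3=\frac{2K}{\mu}\left\{\frac{2^{1+(\beta/2)}c_{\alpha,d}}{(1-\mathrm{e}^{-2\sqrt{\pi d\mu}})\{\cos d\}^{(\alpha+\beta)/2}}\sqrt{\frac{\pi}{d\mu}}+1.1\cdot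 2^{(1-\alpha+|1-\alpha|)/2}\right\},$$ with $c_{\alpha,d}=\{2(1+1/\cos d)\}^{(1-\alpha)/2}$ if $0<\alpha<1$ and $c_{\alpha,d}=2^{(\alpha-1)/2}$ if $\alpha\ge1$. -/

import Mathlib

open MeasureTheory

noncomputable section

/-- The strip `{ζ ∈ ℂ : |Im ζ| < d}`. -/
def strip (d : ℝ) : Set ℂ := {ζ : ℂ | |ζ.im| < d}

/-- The principal branch of the inverse hyperbolic sine, `log (w + √(1 + w²))`, with the principal
branches of the logarithm and of the square root. -/
def carcsinh (w : ℂ) : ℂ := Complex.log (w + (1 + w ^ 2) ^ (1 / 2 : ℂ))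

/-- The single-exponential map of case 2, `ζ ↦ exp ζ`. -/
def seMap₂ (ζ : ℂ) : ℂ := Complex.exp ζ

/-- The single-exponential map of case 3, `ζ ↦ arcsinh (exp ζ)`. -/
def seMap₃ (ζ : ℂ) : ℂ := carcsinh (Complex.exp ζ)

/-- The inverse `(0, ∞) → ℝ` of `seMap₂` restricted to the real line. -/
def seInv₂ (τ : ℝ) : ℝ := Real.log τ

/-- The inverse `(0, ∞) → ℝ` of `seMap₃` restricted to the real line. -/
def seInv₃ (τ : ℝ) : ℝ := Real.log (Real.sinh τ)

/-- `E₂(z; α, β) = z^(α-1) / (1 + z²)^((α+β)/2)`, principal branches. -/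
def E₂ (z : ℂ) (α β : ℝ) : ℂ :=
  z ^ ((α - 1 : ℝ) : ℂ) / (1 + z ^ 2) ^ (((α + β) / 2 : ℝ) : ℂ)

/-- `E₃(z; α, β) = (z / (1 + z))^(α-1) · exp (-β z)`, principal branch. -/
def E₃ (z : ℂ) (α β : ℝ) : ℂ :=
  (z / (1 + z)) ^ ((α - 1 : ℝ) : ℂ) * Complex.exp (-(β : ℂ) * z)

/-- The sine integral `Si x = ∫₀ˣ (sin σ) / σ dσ`. -/
def sineIntegral (x : ℝ) : ℝ := ∫ σ in (0 : ℝ)..x, Real.sin σ / σ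

/-- The basis function `J(k, h)(x) = h (1/2 + (1/π) Si (π (x/h - k)))`. -/
def sincJ (k : ℤ) (h : ℝ) (x : ℝ) : ℝ :=
  h * (1 / 2 + 1 / Real.pi * sineIntegral (Real.pi * (x / h - k)))

/-- The mesh size `h = √(π d / (μ n))` with `μ = min α β`. -/
def meshSize (d α β : ℝ) (n : ℕ) : ℝ := Real.sqrt (Real.pi * d / (min α β * n))

/-- The lower truncation number: `n` if `μ = α`, and `⌈β n / α⌉` otherwise. -/
def truncM (α β : ℝ) (n : ℕ) : ℕ := if min α β = α then n else ⌈β * n / α⌉₊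

/-- The upper truncation number: `⌈α n / β⌉` if `μ = α`, and `n` otherwise. -/
def truncN (α β : ℝ) (n : ℕ) : ℕ := if min α β = α then ⌈α * n / β⌉₊ else n

/-- The Sinc approximation `∑_{k=-M}^{N} f(ψ(kh)) ψ'(kh) J(k,h)(ξ)` of the indefinite integral of
`f`, for the variable transformation `ψ` (evaluated at the real nodes `kh`). -/
def sincIndef (ψ f : ℂ → ℂ) (d α β : ℝ) (n : ℕ) (ξ : ℝ) : ℂ :=
  ∑ k ∈ Finset.Icc (-(truncM α β n : ℤ)) (truncN α β n : ℤ),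
    f (ψ (((k : ℝ) * meshSize d α β n : ℝ) : ℂ)) *
      deriv ψ (((k : ℝ) * meshSize d α β n : ℝ) : ℂ) *
      (sincJ k (meshSize d α β n) ξ : ℂ)

/-- The constant `c_{α,d}`. -/
def constc (α d : ℝ) : ℝ :=
  if α < 1 then (2 * (1 + 1 / Real.cos d)) ^ ((1 - α) / 2) else 2 ^ ((α - 1) / 2)

/-- The constant `C₂`. -/
def constC₂ (K d α β : ℝ) : ℝ :=
  2 * K / min α β *
    (1 / ((1 - Real.exp (-(2 * Real.sqrt (Real.pi * d * min α β)))) *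
          Real.cos d ^ ((α + β) / 2)) * Real.sqrt (Real.pi / (d * min α β)) + 1.1)

/-- The constant `C₃`. -/
def constC₃ (K d α β : ℝ) : ℝ :=
  2 * K / min α β *
    (2 ^ (1 + β / 2) * constc α d /
        ((1 - Real.exp (-(2 * Real.sqrt (Real.pi * d * min α β)))) *
          Real.cos d ^ ((α + β) / 2)) * Real.sqrt (Real.pi / (d * min α β)) +
      1.1 * 2 ^ ((1 - α + |1 - α|) / 2))

/-- On the real line, `seMap₂` is the real exponential. -/
theorem seMap₂_ofReal (x : ℝ) : seMap₂ x = (Real.exp x : ℂ) := by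
  simp [seMap₂]

/-- On the real line, `carcsinh` is the real inverse hyperbolic sine. -/
theorem carcsinh_ofReal (x : ℝ) : carcsinh x = (Real.arsinh x : ℂ) := by
  have h1 : (0 : ℝ) ≤ 1 + x ^ 2 := by positivity
  have h2 : ((1 : ℂ) + (x : ℂ) ^ 2) ^ (1 / 2 : ℂ) = (Real.sqrt (1 + x ^ 2) : ℂ) := by
    rw [Real.sqrt_eq_rpow, Complex.ofReal_cpow h1]
    push_cast
    rfl
  have h3 : (0 : ℝ) ≤ x + Real.sqrt (1 + x ^ 2) := by
    rw [← Real.exp_arsinh]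
    exact (Real.exp_pos _).le
  rw [carcsinh, h2, Real.arsinh, Complex.ofReal_log h3]
  push_cast
  rfl

/-- On the real line, `seMap₃` is `x ↦ arcsinh (exp x)`. -/
theorem seMap₃_ofReal (x : ℝ) : seMap₃ x = (Real.arsinh (Real.exp x) : ℂ) := by
  rw [seMap₃, ← Complex.ofReal_exp, carcsinh_ofReal]

theorem seMap₂_seInv₂ {τ : ℝ} (hτ : 0 < τ) : seMap₂ (seInv₂ τ) = τ := by
  rw [seMap₂_ofReal, seInv₂, Real.exp_log hτ]

theorem seMap₃_seInv₃ {τ : ℝ} (hτ : 0 < τ) : seMap₃ (seInv₃ τ) = τ := by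
  rw [seMap₃_ofReal, seInv₃, Real.exp_log (Real.sinh_pos_iff.mpr hτ), Real.arsinh_sinh]

end

noncomputable section

/-! Substituting `t = ψ(x)` turns the indefinite integral of `f` over `(0, τ]` into that of `g = (f
∘ ψ) · ψ'` over `(-∞, ξ]`, with `g` analytic on the strip and `‖g ζ‖ ≤ B exp(-μ|Re ζ|)` there
(`sincIndef_error_le`). The approximation is the integrated cardinal series of `g`, cut off at `-M`
and `N`, and the two errors are estimated separately.

Discretization. Expanding `(1 - sin πt / sin πz)/(z - t)` in sinc functions (`hasSum_sinc_div_sub`)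
and inserting Cauchy's formula on the strip (`cauchy_strip`) for `g(x)` and for all samples `g(k)`
expresses the remainder of the cardinal series as integrals of `g(z)/sin πz · sin πx/(z - x)` over
the lines `Im z = ±y` (`hasSum_cardinalSeries`). After integration in `x`, the oscillation of `sin
πx` keeps the kernel bounded uniformly in the length of the interval
(`norm_integral_sin_div_line_sub_le`), while `1/|sin πz| ≤ 1/sinh πy` supplies the exponential
smallness. Letting `y → d` and rescaling by `h` gives a bound of order `exp(-πd/h)`.

Truncation. `|Si| ≤ 0.6 π` gives `|J(k,h)| ≤ 1.1 h`, so the omitted terms are dominated by two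
geometric tails (`norm_tsum_sub_sum_Icc_le`). The mesh makes `πd/h = μnh`, and `M`, `N` are large
enough that both tails match that rate (`norm_integral_Iic_sub_sum_sincJ_le`).

What remains is the decay of `g`. The exponential maps the strip into the sector `cos d · ‖w‖ ≤ Re
w`, where `1 + w²` stays comparable to `1 + ‖w‖²` (`sector_le_norm_one_add_sq`); this settles case 2
and, with estimates of `arcsinh` on the sector, case 3. The samples lie on the real line, where the
same estimates hold with `c = 1` in place of `cos d`; this is why `cos d` is absent from the `1.1`
terms. -/

/-! ### The sine integral and the uniform bound on `J(k, h)` -/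

theorem sineIntegral_eq_integral_sinc (x : ℝ) :
    sineIntegral x = ∫ σ in (0 : ℝ)..x, Real.sinc σ := by
  unfold sineIntegral
  refine intervalIntegral.integral_congr_ae ?_
  filter_upwards [(measure_eq_zero_iff_ae_notMem.mp (measure_singleton (μ := volume) (0 : ℝ)))]
    with σ hσ _
  rw [Real.sinc_of_ne_zero hσ]

theorem hasDerivAt_sineIntegral (x : ℝ) : HasDerivAt sineIntegral (Real.sinc x) x := by
  rw [funext sineIntegral_eq_integral_sinc]
  exact Real.continuous_sinc.integral_hasStrictDerivAt 0 x |>.hasDerivAt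

theorem continuous_sineIntegral : Continuous sineIntegral :=
  continuous_iff_continuousAt.mpr fun x => (hasDerivAt_sineIntegral x).continuousAt

theorem sineIntegral_zero : sineIntegral 0 = 0 := by simp [sineIntegral]

theorem sineIntegral_neg (x : ℝ) : sineIntegral (-x) = -sineIntegral x := by
  rw [sineIntegral_eq_integral_sinc, sineIntegral_eq_integral_sinc]
  have := intervalIntegral.integral_comp_neg (a := 0) (b := x) Real.sinc
  simp only [Real.sinc_neg, neg_zero] at this
  rw [this, intervalIntegral.integral_symm]

theorem sub_nonneg_of_hasDerivAt {F F' : ℝ → ℝ} (h : ∀ x, HasDerivAt F (F' x) x)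
    (h0 : 0 ≤ F 0) (hF' : ∀ x, 0 ≤ x → 0 ≤ F' x) {x : ℝ} (hx : 0 ≤ x) : 0 ≤ F x := by
  have hm : MonotoneOn F (Set.Ici 0) := by
    refine monotoneOn_of_hasDerivWithinAt_nonneg (convex_Ici 0)
      (fun y _ => (h y).continuousAt.continuousWithinAt)
      (fun y _ => (h y).hasDerivWithinAt) fun y hy => hF' y ?_
    rw [interior_Ici] at hy
    exact hy.le
  exact h0.trans (hm (by simp) hx hx)

/-- Integrating `1 - cos ≥ 0` repeatedly from `0` produces the alternating Taylor bounds. Degree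
nine is needed for `Si(π) ≤ 0.6 π ≈ 1.885`: the degree-five bound only gives about `1.93`, the
degree-nine bound about `1.853`. -/
theorem sin_le_taylor_nine {x : ℝ} (hx : 0 ≤ x) :
    Real.sin x ≤ x - x ^ 3 / 6 + x ^ 5 / 120 - x ^ 7 / 5040 + x ^ 9 / 362880 := by
  have c1 : ∀ x : ℝ, 0 ≤ x → 0 ≤ 1 - Real.cos x := fun x _ => by linarith [Real.cos_le_one x]
  have s1 : ∀ x : ℝ, 0 ≤ x → 0 ≤ x - Real.sin x := fun x hx =>
    sub_nonneg_of_hasDerivAt (fun y => (hasDerivAt_id y).sub (Real.hasDerivAt_sin y))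
      (by simp) c1 hx
  have c2 : ∀ x : ℝ, 0 ≤ x → 0 ≤ Real.cos x - (1 - x ^ 2 / 2) := fun x hx => by
    refine sub_nonneg_of_hasDerivAt (F := fun x => Real.cos x - (1 - x ^ 2 / 2))
      (F' := fun x => x - Real.sin x) (fun y => ?_) (by simp) s1 hx
    convert! (Real.hasDerivAt_cos y).sub (((hasDerivAt_pow 2 y).div_const 2).const_sub 1) using 1
    simp; ring
  have s2 : ∀ x : ℝ, 0 ≤ x → 0 ≤ Real.sin x - (x - x ^ 3 / 6) := fun x hx => by
    refine sub_nonneg_of_hasDerivAt (F := fun x => Real.sin x - (x - x ^ 3 / 6))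
      (fun y => ?_) (by simp) c2 hx
    convert! (Real.hasDerivAt_sin y).sub ((hasDerivAt_id y).sub ((hasDerivAt_pow 3 y).div_const 6))
      using 1
    simp; ring
  have c3 : ∀ x : ℝ, 0 ≤ x → 0 ≤ (1 - x ^ 2 / 2 + x ^ 4 / 24) - Real.cos x := fun x hx => by
    refine sub_nonneg_of_hasDerivAt (F := fun x => (1 - x ^ 2 / 2 + x ^ 4 / 24) - Real.cos x)
      (fun y => ?_) (by simp) s2 hx
    convert! ((((hasDerivAt_pow 2 y).div_const 2).const_sub 1).add
      ((hasDerivAt_pow 4 y).div_const 24)).sub (Real.hasDerivAt_cos y) using 1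
    simp; ring
  have s3 : ∀ x : ℝ, 0 ≤ x → 0 ≤ (x - x ^ 3 / 6 + x ^ 5 / 120) - Real.sin x := fun x hx => by
    refine sub_nonneg_of_hasDerivAt (F := fun x => (x - x ^ 3 / 6 + x ^ 5 / 120) - Real.sin x)
      (fun y => ?_) (by simp) c3 hx
    convert! (((hasDerivAt_id y).sub ((hasDerivAt_pow 3 y).div_const 6)).add
      ((hasDerivAt_pow 5 y).div_const 120)).sub (Real.hasDerivAt_sin y) using 1
    simp; ring
  have c4 : ∀ x : ℝ, 0 ≤ x → 0 ≤ Real.cos x - (1 - x ^ 2 / 2 + x ^ 4 / 24 - x ^ 6 / 720) :=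
    fun x hx => by
    refine sub_nonneg_of_hasDerivAt
      (F := fun x => Real.cos x - (1 - x ^ 2 / 2 + x ^ 4 / 24 - x ^ 6 / 720))
      (fun y => ?_) (by simp) s3 hx
    convert! (Real.hasDerivAt_cos y).sub (((((hasDerivAt_pow 2 y).div_const 2).const_sub 1).add
      ((hasDerivAt_pow 4 y).div_const 24)).sub ((hasDerivAt_pow 6 y).div_const 720)) using 1
    simp; ring
  have s4 : ∀ x : ℝ, 0 ≤ x → 0 ≤ Real.sin x - (x - x ^ 3 / 6 + x ^ 5 / 120 - x ^ 7 / 5040) :=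
    fun x hx => by
    refine sub_nonneg_of_hasDerivAt
      (F := fun x => Real.sin x - (x - x ^ 3 / 6 + x ^ 5 / 120 - x ^ 7 / 5040))
      (fun y => ?_) (by simp) c4 hx
    convert! (Real.hasDerivAt_sin y).sub ((((hasDerivAt_id y).sub
      ((hasDerivAt_pow 3 y).div_const 6)).add
      ((hasDerivAt_pow 5 y).div_const 120)).sub ((hasDerivAt_pow 7 y).div_const 5040)) using 1
    simp; ring
  have c5 : ∀ x : ℝ, 0 ≤ x →
      0 ≤ (1 - x ^ 2 / 2 + x ^ 4 / 24 - x ^ 6 / 720 + x ^ 8 / 40320) - Real.cos x := fun x hx => by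
    refine sub_nonneg_of_hasDerivAt
      (F := fun x => (1 - x ^ 2 / 2 + x ^ 4 / 24 - x ^ 6 / 720 + x ^ 8 / 40320) - Real.cos x)
      (fun y => ?_) (by simp) s4 hx
    convert! ((((((hasDerivAt_pow 2 y).div_const 2).const_sub 1).add
      ((hasDerivAt_pow 4 y).div_const 24)).sub ((hasDerivAt_pow 6 y).div_const 720)).add
      ((hasDerivAt_pow 8 y).div_const 40320)).sub (Real.hasDerivAt_cos y) using 1
    simp; ring
  have s5 := sub_nonneg_of_hasDerivAt
    (F := fun x => (x - x ^ 3 / 6 + x ^ 5 / 120 - x ^ 7 / 5040 + x ^ 9 / 362880) - Real.sin x)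
    (fun y => by
      convert! (((((hasDerivAt_id y).sub ((hasDerivAt_pow 3 y).div_const 6)).add
        ((hasDerivAt_pow 5 y).div_const 120)).sub ((hasDerivAt_pow 7 y).div_const 5040)).add
        ((hasDerivAt_pow 9 y).div_const 362880)).sub (Real.hasDerivAt_sin y) using 1)
    (by simp) (fun y hy => by convert c5 y hy using 1; simp; ring) hx
  linarith

theorem sineIntegral_pi_le : sineIntegral Real.pi ≤ 0.6 * Real.pi := by
  have h : sineIntegral Real.pi ≤ ∫ σ in (0 : ℝ)..Real.pi,
      (1 - σ ^ 2 / 6 + σ ^ 4 / 120 - σ ^ 6 / 5040 + σ ^ 8 / 362880) := by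
    rw [sineIntegral_eq_integral_sinc]
    refine intervalIntegral.integral_mono_on Real.pi_pos.le
      (Real.continuous_sinc.intervalIntegrable _ _)
      (Continuous.intervalIntegrable (by fun_prop) _ _) fun x hx => ?_
    rcases hx.1.eq_or_lt with h0 | h0
    · simp [← h0]
    · rw [Real.sinc_of_ne_zero h0.ne', div_le_iff₀ h0]
      linarith [sin_le_taylor_nine h0.le]
  have h2 : ∫ σ in (0 : ℝ)..Real.pi,
      (1 - σ ^ 2 / 6 + σ ^ 4 / 120 - σ ^ 6 / 5040 + σ ^ 8 / 362880) =
      Real.pi - Real.pi ^ 3 / 18 + Real.pi ^ 5 / 600 - Real.pi ^ 7 / 35280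
        + Real.pi ^ 9 / 3265920 := by
    have := intervalIntegral.integral_eq_sub_of_hasDerivAt (a := 0) (b := Real.pi)
      (f := fun σ => σ - σ ^ 3 / 18 + σ ^ 5 / 600 - σ ^ 7 / 35280 + σ ^ 9 / 3265920)
      (f' := fun σ => 1 - σ ^ 2 / 6 + σ ^ 4 / 120 - σ ^ 6 / 5040 + σ ^ 8 / 362880)
      (fun y _ => by
        convert! ((((hasDerivAt_id y).sub ((hasDerivAt_pow 3 y).div_const 18)).add
          ((hasDerivAt_pow 5 y).div_const 600)).sub ((hasDerivAt_pow 7 y).div_const 35280)).add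
          ((hasDerivAt_pow 9 y).div_const 3265920) using 1
        simp; ring)
      (Continuous.intervalIntegrable (by fun_prop) _ _)
    simpa using this
  have h3 : Real.pi < 3.1416 := by linarith [Real.pi_lt_d4]
  have h4 : 3.1415 < Real.pi := by linarith [Real.pi_gt_d4]
  have e3 : (3.1415 : ℝ) ^ 3 ≤ Real.pi ^ 3 := by gcongr
  have e7 : (3.1415 : ℝ) ^ 7 ≤ Real.pi ^ 7 := by gcongr
  have e5 : Real.pi ^ 5 ≤ 3.1416 ^ 5 := by gcongr
  have e9 : Real.pi ^ 9 ≤ 3.1416 ^ 9 := by gcongr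
  rw [h2] at h
  norm_num at e3 e5 e7 e9 ⊢
  linarith

theorem monotoneOn_sineIntegral : MonotoneOn sineIntegral (Set.Icc 0 Real.pi) := by
  refine monotoneOn_of_hasDerivWithinAt_nonneg (convex_Icc 0 _)
      continuous_sineIntegral.continuousOn
      (fun y _ => (hasDerivAt_sineIntegral y).hasDerivWithinAt) fun y hy => ?_
  rw [interior_Icc] at hy
  rw [Real.sinc_of_ne_zero hy.1.ne']
  exact div_nonneg (Real.sin_nonneg_of_mem_Icc ⟨hy.1.le, hy.2.le⟩) hy.1.le

/-- Integration by parts with antiderivative `-(1 + cos)` of `sin`: the corrected function `Si y +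
(1 + cos y)/y` decreases, dominates `Si`, and agrees with it at `π` because `cos π = -1`. The lower
bound below uses `1 - cos` in the same way. -/
theorem sineIntegral_le_of_pi_le {x : ℝ} (hx : Real.pi ≤ x) :
    sineIntegral x ≤ sineIntegral Real.pi := by
  have hpos : ∀ y ∈ Set.Ici Real.pi, y ≠ 0 := fun y hy => (Real.pi_pos.trans_le hy).ne'
  have hd : ∀ y ∈ Set.Ici Real.pi, HasDerivAt (fun y => sineIntegral y + (1 + Real.cos y) / y)
      (-(1 + Real.cos y) / y ^ 2) y := fun y hy => by
    convert! (hasDerivAt_sineIntegral y).add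
      (((Real.hasDerivAt_cos y).const_add 1).div (hasDerivAt_id y) (hpos y hy)) using 1
    rw [Real.sinc_of_ne_zero (hpos y hy)]
    have := hpos y hy
    simp only [id]
    field_simp
    ring
  have hm : AntitoneOn (fun y => sineIntegral y + (1 + Real.cos y) / y) (Set.Ici Real.pi) := by
    refine antitoneOn_of_hasDerivWithinAt_nonpos (convex_Ici _)
      (fun y hy => (hd y hy).continuousAt.continuousWithinAt)
      (fun y hy => (hd y (interior_subset hy)).hasDerivWithinAt) fun y hy => ?_
    exact div_nonpos_of_nonpos_of_nonneg (by linarith [Real.neg_one_le_cos y]) (sq_nonneg y)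
  have := hm (Set.mem_Ici.mpr le_rfl) hx hx
  have h2 : 0 ≤ (1 + Real.cos x) / x :=
    div_nonneg (by linarith [Real.neg_one_le_cos x]) (Real.pi_pos.le.trans hx)
  simp at this
  linarith

theorem le_sineIntegral_of_pi_le {x : ℝ} (hx : Real.pi ≤ x) :
    sineIntegral Real.pi - 2 / Real.pi ≤ sineIntegral x := by
  have hpos : ∀ y ∈ Set.Ici Real.pi, y ≠ 0 := fun y hy => (Real.pi_pos.trans_le hy).ne'
  have hd : ∀ y ∈ Set.Ici Real.pi, HasDerivAt (fun y => sineIntegral y - (1 - Real.cos y) / y)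
      ((1 - Real.cos y) / y ^ 2) y := fun y hy => by
    convert! (hasDerivAt_sineIntegral y).sub
      (((Real.hasDerivAt_cos y).const_sub 1).div (hasDerivAt_id y) (hpos y hy)) using 1
    rw [Real.sinc_of_ne_zero (hpos y hy)]
    have := hpos y hy
    simp only [id]
    field_simp
    ring
  have hm : MonotoneOn (fun y => sineIntegral y - (1 - Real.cos y) / y) (Set.Ici Real.pi) := by
    refine monotoneOn_of_hasDerivWithinAt_nonneg (convex_Ici _)
      (fun y hy => (hd y hy).continuousAt.continuousWithinAt)
      (fun y hy => (hd y (interior_subset hy)).hasDerivWithinAt) fun y hy => ?_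
    exact div_nonneg (by linarith [Real.cos_le_one y]) (sq_nonneg y)
  have := hm (Set.mem_Ici.mpr le_rfl) hx hx
  have h2 : 0 ≤ (1 - Real.cos x) / x :=
    div_nonneg (by linarith [Real.cos_le_one x]) (Real.pi_pos.le.trans hx)
  simp at this
  norm_num at this
  linarith

theorem abs_sineIntegral_le (x : ℝ) : |sineIntegral x| ≤ 0.6 * Real.pi := by
  wlog hx : 0 ≤ x generalizing x
  · have := this (-x) (by linarith)
    rwa [sineIntegral_neg, abs_neg] at this
  have hπ := Real.pi_pos
  have h0 : 0 ≤ sineIntegral Real.pi := by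
    simpa [sineIntegral_zero] using
      monotoneOn_sineIntegral (by simp [hπ.le]) (by simp [hπ.le]) hπ.le
  have h2 : 2 / Real.pi ≤ 0.6 * Real.pi := by
    rw [div_le_iff₀ hπ]
    nlinarith [Real.pi_gt_three]
  rw [abs_le]
  rcases le_total x Real.pi with h | h
  · have h1 := monotoneOn_sineIntegral ⟨hx, h⟩ (by simp [hπ.le]) h
    have h3 := monotoneOn_sineIntegral (by simp [hπ.le]) ⟨hx, h⟩ hx
    rw [sineIntegral_zero] at h3
    exact ⟨by linarith, h1.trans sineIntegral_pi_le⟩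
  · exact ⟨by linarith [le_sineIntegral_of_pi_le h],
      (sineIntegral_le_of_pi_le h).trans sineIntegral_pi_le⟩

/-- The source of the constant in the theorem: `1.1 = 1/2 + 0.6`. -/
theorem abs_sincJ_le {h : ℝ} (hh : 0 ≤ h) (k : ℤ) (x : ℝ) : |sincJ k h x| ≤ 1.1 * h := by
  have hπ := Real.pi_pos
  unfold sincJ
  rw [abs_mul, abs_of_nonneg hh, mul_comm]
  gcongr
  have := abs_sineIntegral_le (Real.pi * (x / h - k))
  calc _ ≤ |(1 / 2 : ℝ)| + |1 / Real.pi * sineIntegral (Real.pi * (x / h - k))| := abs_add_le _ _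
    _ ≤ 1 / 2 + 1 / Real.pi * (0.6 * Real.pi) := by
      rw [abs_mul, abs_of_pos (by positivity : 0 < 1 / Real.pi), abs_of_pos (by norm_num : (0:ℝ) < 1/2)]
      gcongr
    _ = 1.1 := by field_simp; norm_num

/-! ### The Dirichlet integral along half-integers -/

theorem integral_dirichletKernel (n : ℕ) :
    ∫ x in (0 : ℝ)..Real.pi, Real.sin ((n + 1 / 2) * x) / (2 * Real.sin (x / 2)) =
      Real.pi / 2 := by
  have key : ∀ x ∈ Set.uIoc 0 Real.pi,
      Real.sin ((n + 1 / 2) * x) / (2 * Real.sin (x / 2)) =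
        1 / 2 + ∑ j ∈ Finset.range n, Real.cos ((j + 1) * x) := by
    intro x hx
    rw [Set.uIoc_of_le Real.pi_pos.le] at hx
    have hs : 0 < Real.sin (x / 2) :=
      Real.sin_pos_of_pos_of_lt_pi (by linarith [hx.1]) (by linarith [hx.2, Real.pi_pos])
    rw [div_eq_iff (by positivity)]
    induction n with
    | zero => simp; ring_nf
    | succ m ih =>
      rw [Finset.sum_range_succ, ← add_assoc, add_mul (1 / 2 + _), ← ih]
      have h1 : ((m + 1 : ℕ) + 1 / 2 : ℝ) * x = (m + 1) * x + x / 2 := by push_cast; ring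
      have h2 : ((m : ℝ) + 1 / 2) * x = (m + 1) * x - x / 2 := by ring
      rw [h1, h2, Real.sin_add, Real.sin_sub]
      ring
  rw [intervalIntegral.integral_congr_ae (Filter.Eventually.of_forall key),
    intervalIntegral.integral_add
    (by simp) (Continuous.intervalIntegrable (by fun_prop) _ _),
    intervalIntegral.integral_finsetSum
      fun i _ => (Continuous.intervalIntegrable (by fun_prop) _ _)]
  rw [Finset.sum_eq_zero]
  · simp; ring
  · intro j _
    have hj : (j : ℝ) + 1 ≠ 0 := by positivity
    rw [intervalIntegral.integral_comp_mul_left (fun y => Real.cos y) hj, integral_cos]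
    have := Real.sin_nat_mul_pi (j + 1)
    push_cast at this
    simp [this]

/-- The two reciprocals have the same pole at `0`, so their difference is bounded, hence integrable,
as the Riemann–Lebesgue lemma requires. Jordan's inequality controls the denominator and the cubic
bound on `sin` the numerator. -/
theorem abs_inv_sub_inv_two_mul_sin_le {x : ℝ} (h0 : 0 < x) (hx : x ≤ Real.pi) :
    |1 / x - 1 / (2 * Real.sin (x / 2))| ≤ 1 := by
  have hs : 2 / Real.pi * (x / 2) ≤ Real.sin (x / 2) :=
    Real.mul_le_sin (by linarith) (by linarith)
  have hs' : 0 < Real.sin (x / 2) := lt_of_lt_of_le (by positivity) hs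
  have hs2 : Real.sin (x / 2) ≤ x / 2 := Real.sin_le (by linarith)
  have hc : 0 ≤ Real.sin (x / 2) - (x / 2 - (x / 2) ^ 3 / 6) := by
    refine sub_nonneg_of_hasDerivAt (F := fun x => Real.sin x - (x - x ^ 3 / 6))
      (F' := fun x => Real.cos x - (1 - x ^ 2 / 2))
      (fun y => ?_) (by simp)
      (fun y _ => by linarith [Real.one_sub_sq_div_two_le_cos (x := y)]) (by linarith)
    convert! (Real.hasDerivAt_sin y).sub ((hasDerivAt_id y).sub ((hasDerivAt_pow 3 y).div_const 6))
      using 1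
    simp; ring
  have hπ := Real.pi_pos
  have hxs : x ≤ Real.pi * Real.sin (x / 2) := by
    have : 2 / Real.pi * (x / 2) = x / Real.pi := by field_simp
    rw [this, div_le_iff₀ hπ] at hs
    linarith
  rw [abs_sub_comm, abs_of_nonneg]
  · rw [div_sub_div _ _ (by positivity) h0.ne', div_le_one (by positivity)]
    have h4 : Real.pi ≤ 4 := Real.pi_le_four
    have h5 : x ≤ 4 * Real.sin (x / 2) := hxs.trans (by gcongr)
    have h6 : x ^ 2 ≤ 4 * x := by nlinarith
    nlinarith [mul_nonneg h0.le hs'.le, mul_le_mul_of_nonneg_left h6 h0.le,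
      mul_le_mul_of_nonneg_left h5 h0.le]
  · rw [sub_nonneg]
    exact one_div_le_one_div_of_le (by positivity) (by linarith)

open Filter Topology in
-- After scaling, `Si(π(n + 1/2))` is the integral of `sin((n + 1/2)v)/v` over `[0, π]`. Replacing
-- `1/v` by `1/(2 sin(v/2))` gives the Dirichlet kernel, with integral exactly `π/2`, and the
-- difference tends to `0` by Riemann–Lebesgue. The limit along half-integers is all that is needed
-- later.
theorem tendsto_sineIntegral_half_integer :
    Tendsto (fun n : ℕ => sineIntegral (Real.pi * (n + 1 / 2))) atTop (𝓝 (Real.pi / 2)) := by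
  have hπ := Real.pi_pos
  set φ : ℝ → ℂ := (Set.Ioc 0 Real.pi).indicator
    fun x => ((1 / x - 1 / (2 * Real.sin (x / 2)) : ℝ) : ℂ) with hφ
  have hint : IntegrableOn (fun x => ((1 / x - 1 / (2 * Real.sin (x / 2)) : ℝ) : ℂ))
      (Set.Ioc 0 Real.pi) := by
    refine Measure.integrableOn_of_bounded (M := 1) (by simp) ?_ ?_
    · exact (Measurable.aestronglyMeasurable (by fun_prop))
    · refine (ae_restrict_iff' measurableSet_Ioc).mpr (Eventually.of_forall fun x hx => ?_)
      rw [Complex.norm_real]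
      exact abs_inv_sub_inv_two_mul_sin_le hx.1 hx.2
  -- `Real.fourierChar` carries a factor `2π`, so the angular frequency `n + 1/2` becomes `(n +
  -- 1/2)/(2π)`.
  have hw : Tendsto (fun n : ℕ => ((n : ℝ) + 1 / 2) / (2 * Real.pi)) atTop (cocompact ℝ) := by
    refine Tendsto.mono_right ?_ atTop_le_cocompact
    exact (tendsto_natCast_atTop_atTop.atTop_add tendsto_const_nhds).atTop_div_const (by positivity)
  have hRL := (Real.tendsto_integral_exp_smul_cocompact φ).comp hw
  have him := ((Complex.continuous_im.tendsto _).comp hRL)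
  have key : ∀ n : ℕ, sineIntegral (Real.pi * (n + 1 / 2)) =
      Real.pi / 2 - (∫ v : ℝ, Real.fourierChar (-(v * (((n : ℝ) + 1 / 2) / (2 * Real.pi)))) •
        φ v).im := by
    intro n
    have hn : (0 : ℝ) < n + 1 / 2 := by positivity
    have e1 : (fun v : ℝ => Real.fourierChar (-(v * (((n : ℝ) + 1 / 2) / (2 * Real.pi)))) •
        φ v) = (Set.Ioc 0 Real.pi).indicator fun v =>
          Real.fourierChar (-(v * (((n : ℝ) + 1 / 2) / (2 * Real.pi)))) •
          ((1 / v - 1 / (2 * Real.sin (v / 2)) : ℝ) : ℂ) := by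
      ext v
      simp only [hφ, Set.indicator_apply, smul_ite, smul_zero]
    have hint2 : IntegrableOn (fun v : ℝ =>
          Real.fourierChar (-(v * (((n : ℝ) + 1 / 2) / (2 * Real.pi)))) •
          ((1 / v - 1 / (2 * Real.sin (v / 2)) : ℝ) : ℂ)) (Set.Ioc 0 Real.pi) := by
      refine (integrable_norm_iff ?_).mp ?_
      · simp only [Circle.smul_def, Real.fourierChar_apply, smul_eq_mul]
        exact Measurable.aestronglyMeasurable (by fun_prop)
      · simpa only [Circle.norm_smul] using hint.norm
    have e2 : (∫ v : ℝ, Real.fourierChar (-(v * (((n : ℝ) + 1 / 2) / (2 * Real.pi)))) •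
        φ v).im = ∫ v in (0 : ℝ)..Real.pi, (Real.sin ((n + 1 / 2) * v) / (2 * Real.sin (v / 2))
          - (n + 1 / 2) * Real.sinc ((n + 1 / 2) * v)) := by
      rw [e1, integral_indicator measurableSet_Ioc, ← Complex.imCLM_apply,
        ← Complex.imCLM.integral_comp_comm hint2, intervalIntegral.integral_of_le hπ.le]
      refine setIntegral_congr_fun measurableSet_Ioc fun v hv => ?_
      have hv0 : v ≠ 0 := hv.1.ne'
      simp only [Circle.smul_def, Real.fourierChar_apply, smul_eq_mul, Complex.imCLM_apply]
      rw [Complex.im_mul_ofReal, Complex.exp_ofReal_mul_I_im, Real.sinc_of_ne_zero (by positivity)]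
      have : 2 * Real.pi * -(v * (((n : ℝ) + 1 / 2) / (2 * Real.pi))) = -((n + 1 / 2) * v) := by
        field_simp
      rw [this, Real.sin_neg]
      field_simp
      ring
    have hi1 : IntervalIntegrable (fun v : ℝ =>
        (n + 1 / 2) * Real.sinc ((n + 1 / 2) * v)) volume 0 Real.pi :=
      Continuous.intervalIntegrable
        (continuous_const.mul (Real.continuous_sinc.comp (by fun_prop))) _ _
    have hi2 : IntervalIntegrable (fun v : ℝ =>
        Real.sin ((n + 1 / 2) * v) / (2 * Real.sin (v / 2))) volume 0 Real.pi := by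
      -- A non-integrable function has integral `0` by convention, which the value `π/2` excludes.
      by_contra hcon
      have := integral_dirichletKernel n
      rw [intervalIntegral.integral_undef hcon] at this
      linarith
    rw [e2, intervalIntegral.integral_sub hi2 hi1, integral_dirichletKernel,
      intervalIntegral.integral_const_mul,
      intervalIntegral.mul_integral_comp_mul_left (f := Real.sinc), sineIntegral_eq_integral_sinc,
      mul_zero, mul_comm Real.pi]
    ring
  simp_rw [key]
  simpa using tendsto_const_nhds.sub him

/-! ### Cardinal expansion of the Cauchy kernel -/

theorem integral_exp_mul_I_neg_pi_pi (a : ℂ) (ha : a ≠ 0) :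
    ∫ θ in (-Real.pi)..Real.pi, Complex.exp (a * Complex.I * θ) =
      2 * Complex.sin (Real.pi * a) / a := by
  have hc : a * Complex.I ≠ 0 := mul_ne_zero ha Complex.I_ne_zero
  rw [integral_exp_mul_complex hc]
  rw [Complex.sin]
  push_cast
  field_simp
  rw [Complex.I_sq]
  ring_nf

theorem integral_exp_real_mul_I_neg_pi_pi (a : ℝ) :
    ∫ θ in (-Real.pi)..Real.pi, Complex.exp (a * Complex.I * θ) =
      2 * Real.pi * Real.sinc (Real.pi * a) := by
  rcases eq_or_ne a 0 with rfl | ha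
  · simp; ring
  · rw [integral_exp_mul_I_neg_pi_pi _ (by exact_mod_cast ha),
      Real.sinc_of_ne_zero (mul_ne_zero Real.pi_ne_zero ha)]
    have : (a : ℂ) ≠ 0 := by exact_mod_cast ha
    have : (Real.pi : ℂ) ≠ 0 := by exact_mod_cast Real.pi_ne_zero
    push_cast
    field_simp

theorem sin_pi_mul_sub_int (z : ℂ) (k : ℤ) :
    Complex.sin (Real.pi * (z - k)) = (-1) ^ k * Complex.sin (Real.pi * z) := by
  have h1 : Complex.sin (k * Real.pi) = 0 := Complex.sin_int_mul_pi k
  have h2 : Complex.cos (k * Real.pi) = (-1) ^ k := by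
    have := congrArg (fun x : ℝ => (x : ℂ)) (Real.cos_int_mul_pi k)
    push_cast at this
    exact this
  rw [mul_sub, mul_comm (Real.pi : ℂ) (k : ℂ), Complex.sin_sub, h1, h2]
  ring

theorem sub_int_mul_sinc (t : ℝ) (k : ℤ) :
    Real.pi * (t - k) * Real.sinc (Real.pi * (t - k)) = (-1) ^ k * Real.sin (Real.pi * t) := by
  have h1 : ∀ x : ℝ, x * Real.sinc x = Real.sin x := fun x => by
    rcases eq_or_ne x 0 with rfl | hx
    · simp
    · rw [Real.sinc_of_ne_zero hx]; field_simp
  rw [h1, mul_sub, mul_comm Real.pi (k : ℝ), Real.sin_sub_int_mul_pi]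

theorem abs_sinc_mul_le (x : ℝ) : |x| * |Real.sinc x| ≤ 1 := by
  rw [← abs_mul]
  rcases eq_or_ne x 0 with rfl | hx
  · simp
  · rw [Real.sinc_of_ne_zero hx, mul_div_cancel₀ _ hx]
    exact Real.abs_sin_le_one x

/-- Interpolation of `1 / (z - t)` in `t` by the cardinal series. -/
theorem hasSum_sinc_div_sub (t : ℝ) {z : ℂ} (hz : z.im ≠ 0)
    (hs : Summable fun k : ℤ => (Real.sinc (Real.pi * (t - k)) : ℂ) / (z - k)) :
    HasSum (fun k : ℤ => (Real.sinc (Real.pi * (t - k)) : ℂ) / (z - k))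
      ((1 - Complex.sin (Real.pi * t) / Complex.sin (Real.pi * z)) / (z - t)) := by
  have hπ := Real.pi_pos
  have hπ' : (Real.pi : ℂ) ≠ 0 := by exact_mod_cast hπ.ne'
  have hzr : ∀ x : ℝ, z - x ≠ 0 := fun x h => hz (by
    have := congrArg Complex.im h
    simpa using this)
  have hzk : ∀ k : ℤ, z - k ≠ 0 := fun k => by simpa using hzr k
  have hsin : Complex.sin (Real.pi * z) ≠ 0 := by
    intro h
    obtain ⟨k, hk⟩ := Complex.sin_eq_zero_iff.mp h
    refine hzk k ?_
    have : (Real.pi : ℂ) * z = Real.pi * k := by rw [hk]; ring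
    rw [mul_left_cancel₀ hπ' this, sub_self]
  have : Fact (0 < 2 * Real.pi) := ⟨by positivity⟩
  set c : ℂ := Complex.sin (Real.pi * t) / Complex.sin (Real.pi * z) with hc
  -- The coefficient `c` is the one that makes the values at `-π` and `π` agree, so that `F` is
  -- continuous on the circle. Its Fourier coefficients are the terms of the series, and its value
  -- at `θ = 0` is the claimed sum.
  set F : ℝ → ℂ := fun θ => (Complex.exp (t * Complex.I * θ) - c * Complex.exp (z * Complex.I * θ))
    / (z - t) with hF
  have hper : F (-Real.pi) = F (-Real.pi + 2 * Real.pi) := by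
    have e : -Real.pi + 2 * Real.pi = Real.pi := by ring
    simp only [hF, e]
    congr 1
    have h1 : Complex.exp (t * Complex.I * (Real.pi : ℝ)) - Complex.exp (t * Complex.I * (-Real.pi : ℝ))
        = 2 * Complex.I * Complex.sin (Real.pi * t) := by
      rw [Complex.sin]; push_cast; ring_nf; rw [Complex.I_sq]; ring
    have h2 : Complex.exp (z * Complex.I * (Real.pi : ℝ)) - Complex.exp (z * Complex.I * (-Real.pi : ℝ))
        = 2 * Complex.I * Complex.sin (Real.pi * z) := by
      rw [Complex.sin]; push_cast; ring_nf; rw [Complex.I_sq]; ring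
    have h3 : c * Complex.sin (Real.pi * z) = Complex.sin (Real.pi * t) := by
      rw [hc]; field_simp
    linear_combination -h1 + c * h2 + 2 * Complex.I * h3
  have hcont : Continuous F := by simp only [hF]; fun_prop
  let G : C(AddCircle (2 * Real.pi), ℂ) :=
    ⟨AddCircle.liftIco (2 * Real.pi) (-Real.pi) F,
      AddCircle.liftIco_continuous hper hcont.continuousOn⟩
  have hcoeff : ∀ k : ℤ, fourierCoeff G k = (Real.sinc (Real.pi * (t - k)) : ℂ) / (z - k) := by
    intro k
    have hG : fourierCoeff G k = (1 / (2 * Real.pi) : ℝ) • ∫ θ in (-Real.pi)..Real.pi,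
        Complex.exp (-((k : ℂ) * Complex.I * θ)) * F θ := by
      rw [fourierCoeff_eq_intervalIntegral _ _ (-Real.pi)]
      have e : -Real.pi + 2 * Real.pi = Real.pi := by ring
      rw [e]
      congr 1
      rw [intervalIntegral.integral_of_le (by linarith), intervalIntegral.integral_of_le (by linarith),
        ← integral_Ico_eq_integral_Ioc, ← integral_Ico_eq_integral_Ioc]
      refine setIntegral_congr_fun measurableSet_Ico fun θ hθ => ?_
      simp only [G, ContinuousMap.coe_mk, smul_eq_mul]
      rw [AddCircle.liftIco_coe_apply (by rwa [e]), fourier_coe_apply]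
      congr 2
      push_cast
      field_simp
    rw [hG]
    have hsplit : ∀ θ : ℝ, Complex.exp (-((k : ℂ) * Complex.I * θ)) * F θ =
        (Complex.exp (((t - k : ℝ) : ℂ) * Complex.I * θ) -
          c * Complex.exp ((z - k) * Complex.I * θ)) / (z - t) := by
      intro θ
      simp only [hF]
      rw [mul_div_assoc', mul_sub, mul_left_comm, ← Complex.exp_add, ← Complex.exp_add]
      push_cast
      ring_nf
    simp_rw [hsplit]
    rw [intervalIntegral.integral_div, intervalIntegral.integral_sub
      (Continuous.intervalIntegrable (by fun_prop) _ _)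
      (Continuous.intervalIntegrable (by fun_prop) _ _), intervalIntegral.integral_const_mul,
      integral_exp_real_mul_I_neg_pi_pi, integral_exp_mul_I_neg_pi_pi _ (hzk k),
      sin_pi_mul_sub_int]
    have h4 : (Real.pi : ℂ) * (t - k) * Real.sinc (Real.pi * (t - k)) =
        (-1) ^ k * Complex.sin (Real.pi * t) := by
      have := congrArg (fun x : ℝ => (x : ℂ)) (sub_int_mul_sinc t k)
      push_cast at this
      exact this
    have h5 : c * (2 * ((-1) ^ k * Complex.sin (Real.pi * z)) / (z - k)) =
        2 * (Real.pi * (t - k) * Real.sinc (Real.pi * (t - k))) / (z - k) := by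
      rw [h4, hc]; field_simp
    rw [h5, Complex.real_smul]
    have := hzr t
    have := hzk k
    push_cast
    field_simp
    ring
  have hsum : Summable (fourierCoeff G) := by
    rw [funext hcoeff]; exact hs
  have := has_pointwise_sum_fourier_series_of_summable hsum ((0 : ℝ) : AddCircle (2 * Real.pi))
  simp only [hcoeff] at this
  have h0 : (0 : ℝ) ∈ Set.Ico (-Real.pi) (-Real.pi + 2 * Real.pi) :=
    ⟨by linarith, by linarith⟩
  have hG0 : G ((0 : ℝ) : AddCircle (2 * Real.pi)) = F 0 := by
    simp only [G, ContinuousMap.coe_mk]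
    exact AddCircle.liftIco_coe_apply h0
  rw [hG0] at this
  simpa [hF] using this

/-! ### Auxiliary integrals and summable families -/

theorem integral_exp_neg_mul_abs {μ : ℝ} (hμ : 0 < μ) :
    ∫ x : ℝ, Real.exp (-(μ * |x|)) = 2 / μ := by
  rw [integral_comp_abs (f := fun x => Real.exp (-(μ * x)))]
  have := integral_exp_mul_Ioi (a := -μ) (by linarith) 0
  simp only [neg_mul] at this
  rw [this]
  simp
  ring

theorem integrable_exp_neg_mul_abs {μ : ℝ} (hμ : 0 < μ) :
    Integrable fun x : ℝ => Real.exp (-(μ * |x|)) :=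
  -- A nonzero Bochner integral forces integrability.
  Integrable.of_integral_ne_zero (by rw [integral_exp_neg_mul_abs hμ]; positivity)

theorem integrable_one_add_abs_mul_exp_neg_mul_abs {μ : ℝ} (hμ : 0 < μ) :
    Integrable fun x : ℝ => (1 + |x|) * Real.exp (-(μ * |x|)) := by
  refine ((integrable_exp_neg_mul_abs (half_pos hμ)).const_mul (1 + 2 / μ)).mono'
    (by fun_prop) (Filter.Eventually.of_forall fun x => ?_)
  rw [Real.norm_of_nonneg (by positivity)]
  have h1 : Real.exp (-(μ * |x|)) = Real.exp (-(μ / 2 * |x|)) * Real.exp (-(μ / 2 * |x|)) := by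
    rw [← Real.exp_add]; ring_nf
  have h2 : (1 + |x|) * Real.exp (-(μ / 2 * |x|)) ≤ 1 + 2 / μ := by
    have h3 : μ / 2 * |x| ≤ Real.exp (μ / 2 * |x|) := by
      linarith [Real.add_one_le_exp (μ / 2 * |x|)]
    have h4 : (1 : ℝ) ≤ Real.exp (μ / 2 * |x|) := Real.one_le_exp (by positivity)
    rw [Real.exp_neg, ← div_eq_mul_inv, div_le_iff₀ (Real.exp_pos _)]
    have h5 : |x| ≤ 2 / μ * Real.exp (μ / 2 * |x|) := by
      calc |x| = 2 / μ * (μ / 2 * |x|) := by field_simp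
        _ ≤ _ := by gcongr
    linarith
  rw [h1, ← mul_assoc]
  gcongr

theorem summable_exp_neg_mul_abs_int {μ : ℝ} (hμ : 0 < μ) :
    Summable fun k : ℤ => Real.exp (-(μ * |(k : ℝ)|)) := by
  have h : Summable fun n : ℕ => Real.exp (-(μ * (n : ℝ))) := by
    have := Real.summable_exp_nat_mul_iff.mpr (neg_lt_zero.mpr hμ)
    refine this.congr fun n => ?_
    ring_nf
  refine Summable.of_nat_of_neg ?_ ?_ <;> simpa using h

theorem summable_inv_one_add_abs_sq : Summable fun k : ℤ => (1 / (1 + |(k : ℝ)|)) ^ 2 := by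
  have h : Summable fun n : ℕ => (1 / (1 + (n : ℝ))) ^ 2 := by
    have := (summable_nat_add_iff 1).mpr (Real.summable_one_div_nat_pow.mpr one_lt_two)
    refine this.congr fun n => ?_
    push_cast
    rw [div_pow, one_pow, add_comm (n : ℝ)]
  refine Summable.of_nat_of_neg ?_ ?_ <;> simpa using h

theorem integral_univ_inv_sub_sq_add_sq {y : ℝ} (hy : y ≠ 0) (x : ℝ) :
    ∫ s : ℝ, ((s - x) ^ 2 + y ^ 2)⁻¹ = Real.pi / |y| := by
  rw [integral_sub_right_eq_self (fun s : ℝ => (s ^ 2 + y ^ 2)⁻¹) x]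
  have h : (fun s : ℝ => (s ^ 2 + y ^ 2)⁻¹) = fun s => (y ^ 2)⁻¹ * (1 + (y⁻¹ * s) ^ 2)⁻¹ := by
    ext s
    rw [← mul_inv]
    congr 1
    field_simp
    ring
  rw [h, integral_const_mul, Measure.integral_comp_mul_left (fun s : ℝ => (1 + s ^ 2)⁻¹),
    integral_univ_inv_one_add_sq, inv_inv, smul_eq_mul, ← sq_abs]
  have := abs_pos.mpr hy
  field_simp

theorem integrable_inv_sub_sq_add_sq {y : ℝ} (hy : y ≠ 0) (x : ℝ) :
    Integrable fun s : ℝ => ((s - x) ^ 2 + y ^ 2)⁻¹ :=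
  Integrable.of_integral_ne_zero (by
    rw [integral_univ_inv_sub_sq_add_sq hy]
    have := abs_pos.mpr hy
    have := Real.pi_pos
    positivity)

/-! ### Functions on a strip and Cauchy's formula -/

theorem ofReal_add_mul_I_mem_strip {d y : ℝ} (hy : |y| < d) (s : ℝ) :
    (s : ℂ) + y * Complex.I ∈ strip d := by
  simpa [strip] using hy

theorem isOpen_strip (d : ℝ) : IsOpen (strip d) :=
  isOpen_lt (by fun_prop) continuous_const

section Strip

variable {g : ℂ → ℂ} {d B μ : ℝ}

theorem continuous_comp_line (hg : DifferentiableOn ℂ g (strip d)) {y : ℝ} (hy : |y| < d) :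
    Continuous fun s : ℝ => g (s + y * Complex.I) :=
  hg.continuousOn.comp_continuous (by fun_prop) (ofReal_add_mul_I_mem_strip hy)

theorem norm_line_le (hb : ∀ ζ ∈ strip d, ‖g ζ‖ ≤ B * Real.exp (-(μ * |ζ.re|))) {y : ℝ}
    (hy : |y| < d) (s : ℝ) : ‖g (s + y * Complex.I)‖ ≤ B * Real.exp (-(μ * |s|)) := by
  simpa using hb _ (ofReal_add_mul_I_mem_strip hy s)

theorem nonneg_of_strip_bound (hd : 0 < d)
    (hb : ∀ ζ ∈ strip d, ‖g ζ‖ ≤ B * Real.exp (-(μ * |ζ.re|))) : 0 ≤ B := by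
  have := norm_line_le hb (y := 0) (by simpa) 0
  simp at this
  exact (norm_nonneg _).trans this

theorem integrable_line (hg : DifferentiableOn ℂ g (strip d)) (hμ : 0 < μ)
    (hb : ∀ ζ ∈ strip d, ‖g ζ‖ ≤ B * Real.exp (-(μ * |ζ.re|))) {y : ℝ} (hy : |y| < d) :
    Integrable fun s : ℝ => g (s + y * Complex.I) :=
  ((integrable_exp_neg_mul_abs hμ).const_mul B).mono'
    (continuous_comp_line hg hy).aestronglyMeasurable
    (Filter.Eventually.of_forall fun s => norm_line_le hb hy s)

theorem integral_norm_line_le (hg : DifferentiableOn ℂ g (strip d)) (hμ : 0 < μ)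
    (hb : ∀ ζ ∈ strip d, ‖g ζ‖ ≤ B * Real.exp (-(μ * |ζ.re|))) {y : ℝ} (hy : |y| < d) :
    ∫ s : ℝ, ‖g (s + y * Complex.I)‖ ≤ 2 * B / μ := by
  calc _ ≤ ∫ s : ℝ, B * Real.exp (-(μ * |s|)) :=
        integral_mono (integrable_line hg hμ hb hy).norm
          ((integrable_exp_neg_mul_abs hμ).const_mul B) fun s => norm_line_le hb hy s
    _ = 2 * B / μ := by rw [integral_const_mul, integral_exp_neg_mul_abs hμ]; ring

theorem abs_le_norm_line_sub (s y : ℝ) (x : ℝ) : |y| ≤ ‖(s : ℂ) + y * Complex.I - x‖ := by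
  simpa using Complex.abs_im_le_norm ((s : ℂ) + y * Complex.I - x)

theorem line_sub_ne_zero {y : ℝ} (hy : y ≠ 0) (s x : ℝ) : (s : ℂ) + y * Complex.I - x ≠ 0 :=
  norm_pos_iff.mp ((abs_pos.mpr hy).trans_le (abs_le_norm_line_sub s y x))

theorem normSq_line_sub (s y x : ℝ) :
    ‖(s : ℂ) + y * Complex.I - x‖ ^ 2 = (s - x) ^ 2 + y ^ 2 := by
  rw [← Complex.normSq_eq_norm_sq, Complex.normSq_apply]
  simp
  ring

theorem integrable_line_div_sub (hg : DifferentiableOn ℂ g (strip d)) (hμ : 0 < μ)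
    (hb : ∀ ζ ∈ strip d, ‖g ζ‖ ≤ B * Real.exp (-(μ * |ζ.re|))) {y : ℝ} (hy : |y| < d)
    (hy0 : y ≠ 0) (x : ℝ) :
    Integrable fun s : ℝ => g (s + y * Complex.I) / (s + y * Complex.I - x) := by
  refine ((integrable_line hg hμ hb hy).norm.mul_const |y|⁻¹).mono'
    ((continuous_comp_line hg hy).div (by fun_prop)
      fun s => line_sub_ne_zero hy0 s x).aestronglyMeasurable
    (Filter.Eventually.of_forall fun s => ?_)
  have := abs_pos.mpr hy0
  rw [norm_div, div_eq_mul_inv]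
  gcongr
  exact abs_le_norm_line_sub s y x

/-- Each kernel alone decays only like `1/|s|` and is not integrable over the line; their difference
is the Poisson-type kernel `2iy / ((s - x)² + y²)`. -/
theorem integral_line_kernel {y : ℝ} (hy : 0 < y) (x : ℝ) :
    Integrable (fun s : ℝ => 1 / ((s : ℂ) + (-y : ℝ) * Complex.I - x)
      - 1 / (s + y * Complex.I - x)) ∧
    ∫ s : ℝ, (1 / ((s : ℂ) + (-y : ℝ) * Complex.I - x) - 1 / (s + y * Complex.I - x)) =
      2 * Real.pi * Complex.I := by
  have h : (fun s : ℝ => 1 / ((s : ℂ) + (-y : ℝ) * Complex.I - x)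
      - 1 / (s + y * Complex.I - x)) =
      fun s : ℝ => 2 * y * Complex.I * (((((s - x) ^ 2 + y ^ 2)⁻¹ : ℝ)) : ℂ) := by
    ext s
    have h1 := line_sub_ne_zero (neg_ne_zero.mpr hy.ne') s x
    have h2 := line_sub_ne_zero hy.ne' s x
    have h3 : ((s : ℂ) + (-y : ℝ) * Complex.I - x) * (s + y * Complex.I - x) =
        (((s - x) ^ 2 + y ^ 2 : ℝ) : ℂ) := by
      push_cast
      linear_combination (-(y : ℂ) ^ 2) * Complex.I_sq
    rw [div_sub_div _ _ h1 h2, h3]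
    push_cast
    rw [div_eq_mul_inv]
    ring
  rw [h]
  refine ⟨(integrable_inv_sub_sq_add_sq hy.ne' x).ofReal.const_mul _, ?_⟩
  rw [integral_const_mul, integral_complex_ofReal, integral_univ_inv_sub_sq_add_sq hy.ne', abs_of_pos hy]
  have : (y : ℂ) ≠ 0 := by exact_mod_cast hy.ne'
  push_cast
  field_simp

open Filter Topology in
/-- Cauchy's integral formula on a strip. -/
theorem cauchy_strip (hg : DifferentiableOn ℂ g (strip d)) (hμ : 0 < μ)
    (hb : ∀ ζ ∈ strip d, ‖g ζ‖ ≤ B * Real.exp (-(μ * |ζ.re|))) {y : ℝ} (hy0 : 0 < y)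
    (hy : y < d) (x : ℝ) :
    (∫ s : ℝ, g (s + (-y : ℝ) * Complex.I) / (s + (-y : ℝ) * Complex.I - x)) -
      (∫ s : ℝ, g (s + y * Complex.I) / (s + y * Complex.I - x)) =
      2 * Real.pi * Complex.I * g x := by
  have hd : 0 < d := hy0.trans hy
  have hB := nonneg_of_strip_bound hd hb
  have hyd : |y| < d := by rwa [abs_of_pos hy0]
  have hyd' : |-y| < d := by rwa [abs_neg]
  have hx : (x : ℂ) ∈ strip d := by simpa [strip] using hd
  -- Filling in the removable singularity of `(g z - g x)/(z - x)` lets Cauchy's theorem on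
  -- rectangles apply without excising `x`; the residue reappears through the kernel integral `2πi`.
  set F : ℂ → ℂ := dslope g x with hF
  have hFd : DifferentiableOn ℂ F (strip d) :=
    (Complex.differentiableOn_dslope ((isOpen_strip d).mem_nhds hx)).mpr hg
  have hFv : ∀ z : ℂ, z ≠ x → F z = (g z - g x) / (z - x) := fun z hz => by
    rw [hF, dslope_of_ne _ hz, slope_def_field]
  have hrect : ∀ R : ℝ, 0 < R →
      (∫ s : ℝ in (-R)..R, F (s + (-y : ℝ) * Complex.I)) - (∫ s : ℝ in (-R)..R, F (s + y * Complex.I))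
      = Complex.I * (∫ t : ℝ in (-y)..y, F ((-R : ℝ) + t * Complex.I)) -
        Complex.I * ∫ t : ℝ in (-y)..y, F (R + t * Complex.I) := by
    intro R hR
    have := Complex.integral_boundary_rect_eq_zero_of_differentiableOn F ⟨-R, -y⟩ ⟨R, y⟩
      (hFd.mono fun z hz => by
        have h2 := hz.2
        simp only [Set.mem_preimage] at h2
        rw [Set.uIcc_of_le (by linarith)] at h2
        exact (abs_le.mpr h2).trans_lt hy)
    simp only [smul_eq_mul] at this
    linear_combination this
  have hbound : ∀ R : ℝ, |x| < R → ∀ r : ℝ, |r| = R →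
      ‖∫ t : ℝ in (-y)..y, F ((r : ℝ) + t * Complex.I)‖ ≤ 2 * B / (R - |x|) * |y - -y| := by
    intro R hR r hr
    refine intervalIntegral.norm_integral_le_of_norm_le_const fun t ht => ?_
    rw [Set.uIoc_of_le (by linarith)] at ht
    have htd : |t| < d := (abs_le.mpr ⟨ht.1.le, ht.2⟩).trans_lt hy
    have hre : R - |x| ≤ ‖(r : ℂ) + t * Complex.I - x‖ := by
      have h1 := Complex.abs_re_le_norm ((r : ℂ) + t * Complex.I - x)
      simp at h1
      have h2 := abs_sub_abs_le_abs_sub r x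
      linarith
    have hpos : 0 < R - |x| := by linarith
    have hne : (r : ℂ) + t * Complex.I ≠ x := fun h => by
      rw [h, sub_self, norm_zero] at hre
      linarith
    have hle1 : ∀ z ∈ strip d, ‖g z‖ ≤ B := fun z hz => (hb z hz).trans
      (mul_le_of_le_one_right hB (Real.exp_le_one_iff.mpr (by
        have := abs_nonneg z.re
        nlinarith)))
    rw [hFv _ hne, norm_div]
    have h3 : ‖g ((r : ℂ) + t * Complex.I) - g x‖ ≤ 2 * B := by
      have h4 := hle1 _ (ofReal_add_mul_I_mem_strip htd r)
      have h5 := hle1 _ hx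
      linarith [norm_sub_le (g ((r : ℂ) + t * Complex.I)) (g x)]
    gcongr
  have hvert : ∀ r : ℝ → ℝ, (∀ R, 0 < R → |r R| = R) → Tendsto (fun R : ℝ =>
      ∫ t : ℝ in (-y)..y, F ((r R : ℝ) + t * Complex.I)) atTop (𝓝 0) := by
    intro r hr
    have hlim : Tendsto (fun R : ℝ => 2 * B / (R - |x|) * |y - -y|) atTop (𝓝 0) := by
      have : Tendsto (fun R : ℝ => R - |x|) atTop atTop :=
        tendsto_atTop_add_const_right _ _ tendsto_id
      simpa using (this.const_div_atTop (2 * B)).mul_const |y - -y|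
    refine squeeze_zero_norm' ?_ hlim
    filter_upwards [eventually_gt_atTop |x|] with R hR
    exact hbound R hR (r R) (hr R ((abs_nonneg x).trans_lt hR))
  have hzero : Tendsto (fun R : ℝ => (∫ s : ℝ in (-R)..R, F (s + (-y : ℝ) * Complex.I)) -
      (∫ s : ℝ in (-R)..R, F (s + y * Complex.I))) atTop (𝓝 0) := by
    have h1 := hvert (fun R => -R) fun R hR => by rw [abs_neg, abs_of_pos hR]
    have h2 := hvert (fun R => R) fun R hR => abs_of_pos hR
    have h3 := (h1.const_mul Complex.I).sub (h2.const_mul Complex.I)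
    simp only [mul_zero, sub_zero] at h3
    refine h3.congr' ?_
    filter_upwards [eventually_gt_atTop 0] with R hR
    exact (hrect R hR).symm
  obtain ⟨hki, hkv⟩ := integral_line_kernel hy0 x
  have hi1 := integrable_line_div_sub hg hμ hb hyd' (neg_ne_zero.mpr hy0.ne') x
  have hi2 := integrable_line_div_sub hg hμ hb hyd hy0.ne' x
  -- The two lines are merged before passing to the limit, since the part `g x / (z - x)` is
  -- integrable only as a difference.
  have hlimit : Tendsto (fun R : ℝ => (∫ s : ℝ in (-R)..R, F (s + (-y : ℝ) * Complex.I)) -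
      (∫ s : ℝ in (-R)..R, F (s + y * Complex.I))) atTop
      (𝓝 (∫ s : ℝ, (g (s + (-y : ℝ) * Complex.I) / (s + (-y : ℝ) * Complex.I - x) -
        g (s + y * Complex.I) / (s + y * Complex.I - x) -
        g x * (1 / ((s : ℂ) + (-y : ℝ) * Complex.I - x) - 1 / (s + y * Complex.I - x))))) := by
    have hlineF : ∀ v : ℝ, |v| < d → Continuous fun s : ℝ => F (s + v * Complex.I) :=
      fun v hv => continuous_comp_line hFd hv
    refine (intervalIntegral_tendsto_integral ((hi1.sub hi2).sub (hki.const_mul (g x)))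
      tendsto_neg_atTop_atBot tendsto_id).congr fun R => ?_
    rw [← intervalIntegral.integral_sub ((hlineF _ hyd').intervalIntegrable _ _)
      ((hlineF _ hyd).intervalIntegrable _ _)]
    refine intervalIntegral.integral_congr fun s _ => ?_
    have h1 := line_sub_ne_zero (neg_ne_zero.mpr hy0.ne') s x
    have h2 := line_sub_ne_zero hy0.ne' s x
    simp only [Pi.sub_apply]
    rw [hFv _ (sub_ne_zero.mp h1), hFv _ (sub_ne_zero.mp h2)]
    ring
  have := tendsto_nhds_unique hlimit hzero
  have hsplit := integral_sub (hi1.sub hi2) (hki.const_mul (g x))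
  simp only [Pi.sub_apply] at hsplit
  rw [hsplit, integral_sub hi1 hi2, integral_const_mul, hkv] at this
  linear_combination this

end Strip

/-! ### Estimates for the remainder kernel -/

theorem one_add_abs_mul_abs_sinc_le (t : ℝ) (k : ℤ) :
    (1 + |(k : ℝ)|) * |Real.sinc (Real.pi * (t - k))| ≤ 2 + |t| := by
  have h1 := abs_sinc_mul_le (Real.pi * (t - k))
  have h2 := Real.abs_sinc_le_one (Real.pi * (t - k))
  have h3 : |(k : ℝ)| ≤ |t| + |t - k| := by
    have := abs_sub_abs_le_abs_sub (k : ℝ) t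
    rw [abs_sub_comm] at this
    linarith
  have h4 : |t - k| ≤ |Real.pi * (t - k)| := by
    rw [abs_mul, abs_of_pos Real.pi_pos]
    exact le_mul_of_one_le_left (abs_nonneg _) (by linarith [Real.pi_gt_three])
  set σ := |Real.sinc (Real.pi * (t - k))|
  have hσ : 0 ≤ σ := abs_nonneg _
  calc (1 + |(k : ℝ)|) * σ ≤ (1 + |t| + |Real.pi * (t - k)|) * σ := by
        refine mul_le_mul_of_nonneg_right ?_ hσ
        linarith
    _ = (1 + |t|) * σ + |Real.pi * (t - k)| * σ := by ring
    _ ≤ (1 + |t|) * 1 + 1 := by gcongr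
    _ = 2 + |t| := by ring

/-- Together with the sinc bound above, this makes `sinc(π(x - k))/(z - k)` of order `(1 + |s|)/(1 +
|k|)²`: summable in `k`, with linear growth in `s` that the exponential decay of `g` absorbs. -/
theorem one_add_abs_le_mul_norm_line_sub {y : ℝ} (hy : y ≠ 0) (s : ℝ) (k : ℤ) :
    1 + |(k : ℝ)| ≤ (1 / |y| + 1) * (1 + |s|) * ‖(s : ℂ) + y * Complex.I - k‖ := by
  have hy' := abs_pos.mpr hy
  have h1 : |y| ≤ ‖(s : ℂ) + y * Complex.I - k‖ := by
    simpa using abs_le_norm_line_sub s y k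
  have h2 : |s - k| ≤ ‖(s : ℂ) + y * Complex.I - k‖ := by
    simpa using Complex.abs_re_le_norm ((s : ℂ) + y * Complex.I - k)
  have h3 : |(k : ℝ)| ≤ |s| + |s - k| := by
    have := abs_sub_abs_le_abs_sub (k : ℝ) s
    rw [abs_sub_comm] at this
    linarith
  set r := ‖(s : ℂ) + y * Complex.I - k‖
  have hr : 0 ≤ r := norm_nonneg _
  have h4 : 1 + |s| ≤ 1 / |y| * (1 + |s|) * r := by
    calc 1 + |s| = 1 / |y| * (1 + |s|) * |y| := by field_simp
      _ ≤ _ := by gcongr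
  have h5 : r ≤ (1 + |s|) * r := le_mul_of_one_le_left hr (by linarith [abs_nonneg s])
  linarith

theorem sinh_le_norm_sin (w : ℂ) : Real.sinh |w.im| ≤ ‖Complex.sin w‖ := by
  have h : Complex.sin w = (Complex.exp (-w * Complex.I) - Complex.exp (w * Complex.I)) *
    Complex.I / 2 := rfl
  rw [← Real.abs_sinh, h, norm_div, norm_mul, Complex.norm_I, mul_one, Complex.norm_ofNat,
    Real.sinh_eq, abs_div, abs_of_pos (two_pos : (0 : ℝ) < 2)]
  gcongr
  have := abs_norm_sub_norm_le (Complex.exp (-w * Complex.I)) (Complex.exp (w * Complex.I))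
  simpa [Complex.norm_exp] using this

theorem sinh_le_norm_sin_pi_line (s y : ℝ) :
    Real.sinh (Real.pi * |y|) ≤ ‖Complex.sin (Real.pi * (s + y * Complex.I))‖ := by
  have := sinh_le_norm_sin (Real.pi * (s + y * Complex.I))
  simpa [abs_mul, abs_of_pos Real.pi_pos] using this

theorem sin_pi_line_ne_zero {y : ℝ} (hy : y ≠ 0) (s : ℝ) :
    Complex.sin (Real.pi * (s + y * Complex.I)) ≠ 0 :=
  norm_pos_iff.mp ((Real.sinh_pos_iff.mpr (mul_pos Real.pi_pos (abs_pos.mpr hy))).trans_le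
    (sinh_le_norm_sin_pi_line s y))

/-- Integrate by parts with antiderivative `-cos(πx)/π`. The boundary term at `A` vanishes by
`hcos`, the one at `ξ` is at most `1/(π|y|)`, and the remaining integral is at most `(1/π) ·
(π/|y|)`. The bound does not depend on `ξ - A`, so `A → -∞` is harmless. -/
theorem norm_integral_sin_div_line_sub_le {y : ℝ} (hy : y ≠ 0) (s : ℝ) {A ξ : ℝ} (hA : A ≤ ξ)
    (hcos : Real.cos (Real.pi * A) = 0) :
    ‖∫ x in A..ξ, (Real.sin (Real.pi * x) : ℂ) / ((s : ℂ) + y * Complex.I - x)‖ ≤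
      (1 / Real.pi + 1) / |y| := by
  have hπ := Real.pi_pos
  have hy' := abs_pos.mpr hy
  have hne := line_sub_ne_zero hy s
  have hu : ∀ x ∈ Set.uIcc A ξ, HasDerivAt (fun x : ℝ => ((s : ℂ) + y * Complex.I - x)⁻¹)
      (((s : ℂ) + y * Complex.I - x) ^ 2)⁻¹ x := fun x _ => by
    convert! ((Complex.ofRealCLM.hasDerivAt (x := x)).const_sub
      ((s : ℂ) + y * Complex.I)).inv (hne x) using 1
    simp
  have hv : ∀ x ∈ Set.uIcc A ξ, HasDerivAt
      (fun x : ℝ => ((-(Real.cos (Real.pi * x) / Real.pi) : ℝ) : ℂ))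
      (Real.sin (Real.pi * x) : ℂ) x := fun x _ => by
    refine HasDerivAt.ofReal_comp ?_
    convert! ((((hasDerivAt_id x).const_mul Real.pi).cos).div_const Real.pi).neg using 1
    simp
    field_simp
  have hcont : Continuous fun x : ℝ => (((s : ℂ) + y * Complex.I - x) ^ 2)⁻¹ :=
    Continuous.inv₀ (by fun_prop) fun x => pow_ne_zero 2 (hne x)
  have hparts := intervalIntegral.integral_mul_deriv_eq_deriv_mul hu hv
    (hcont.intervalIntegrable _ _) (Continuous.intervalIntegrable (by fun_prop) _ _)
  have heq : ∫ x in A..ξ, (Real.sin (Real.pi * x) : ℂ) / ((s : ℂ) + y * Complex.I - x) =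
      ∫ x in A..ξ, ((s : ℂ) + y * Complex.I - x)⁻¹ * (Real.sin (Real.pi * x) : ℂ) :=
    intervalIntegral.integral_congr fun x _ => by simp only [div_eq_inv_mul]
  rw [heq, hparts, hcos]
  have hcosle : ∀ x : ℝ, ‖((-(Real.cos (Real.pi * x) / Real.pi) : ℝ) : ℂ)‖ ≤ 1 / Real.pi :=
    fun x => by
    rw [Complex.norm_real, norm_neg, norm_div, Real.norm_of_nonneg hπ.le]
    gcongr
    exact Real.abs_cos_le_one _
  have h1 : ‖((s : ℂ) + y * Complex.I - ξ)⁻¹ *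
      ((-(Real.cos (Real.pi * ξ) / Real.pi) : ℝ) : ℂ)‖ ≤ |y|⁻¹ * (1 / Real.pi) := by
    rw [norm_mul, norm_inv]
    gcongr
    · exact abs_le_norm_line_sub s y ξ
    · exact hcosle ξ
  have hpt : ∀ x : ℝ, ‖(((s : ℂ) + y * Complex.I - x) ^ 2)⁻¹ *
        ((-(Real.cos (Real.pi * x) / Real.pi) : ℝ) : ℂ)‖ ≤
        ((x - s) ^ 2 + y ^ 2)⁻¹ * (1 / Real.pi) := fun x => by
    rw [norm_mul, norm_inv, norm_pow, normSq_line_sub, ← neg_sq (s - x), neg_sub]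
    gcongr
    exact hcosle x
  have hint : Integrable fun x : ℝ => ((x - s) ^ 2 + y ^ 2)⁻¹ * (1 / Real.pi) :=
    (integrable_inv_sub_sq_add_sq hy s).mul_const _
  have h2 : ‖∫ x in A..ξ, (((s : ℂ) + y * Complex.I - x) ^ 2)⁻¹ *
      ((-(Real.cos (Real.pi * x) / Real.pi) : ℝ) : ℂ)‖ ≤ 1 / |y| := by
    calc _ ≤ ∫ x in A..ξ, ((x - s) ^ 2 + y ^ 2)⁻¹ * (1 / Real.pi) :=
          intervalIntegral.norm_integral_le_of_norm_le hA
            (Filter.Eventually.of_forall fun x _ => hpt x) hint.intervalIntegrable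
      _ ≤ ∫ x : ℝ, ((x - s) ^ 2 + y ^ 2)⁻¹ * (1 / Real.pi) := by
          rw [intervalIntegral.integral_of_le hA]
          exact setIntegral_le_integral hint
            (Filter.Eventually.of_forall fun x => by positivity)
      _ = 1 / |y| := by
          rw [integral_mul_const, integral_univ_inv_sub_sq_add_sq hy]
          field_simp
  calc _ ≤ |y|⁻¹ * (1 / Real.pi) + 1 / |y| := by
        refine (norm_sub_le _ _).trans (add_le_add ?_ h2)
        simpa using h1
    _ = _ := by field_simp

section Strip

variable {g : ℂ → ℂ} {d B μ : ℝ}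

/-- The cardinal expansion of the Cauchy kernel, multiplied by `g` and integrated termwise along one
line; the exchange is justified by summability of the `L¹` norms. -/
theorem hasSum_sinc_mul_integral_line (hg : DifferentiableOn ℂ g (strip d)) (hμ : 0 < μ)
    (hb : ∀ ζ ∈ strip d, ‖g ζ‖ ≤ B * Real.exp (-(μ * |ζ.re|))) {y : ℝ} (hy : |y| < d)
    (hy0 : y ≠ 0) (x : ℝ) :
    HasSum (fun k : ℤ => (∫ s : ℝ, g (s + y * Complex.I) / (s + y * Complex.I - k)) *
        (Real.sinc (Real.pi * (x - k)) : ℂ))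
      ((∫ s : ℝ, g (s + y * Complex.I) / (s + y * Complex.I - x)) -
        ∫ s : ℝ, g (s + y * Complex.I) / Complex.sin (Real.pi * (s + y * Complex.I)) *
          ((Real.sin (Real.pi * x) : ℂ) / (s + y * Complex.I - x))) := by
  have hB := nonneg_of_strip_bound ((abs_nonneg y).trans_lt hy) hb
  have hy' := abs_pos.mpr hy0
  set F : ℤ → ℝ → ℂ := fun k s =>
    g (s + y * Complex.I) / (s + y * Complex.I - k) * (Real.sinc (Real.pi * (x - k)) : ℂ) with hF
  have hFint : ∀ k, Integrable (F k) := fun k => by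
    have := (integrable_line_div_sub hg hμ hb hy hy0 k).mul_const
      (Real.sinc (Real.pi * (x - k)) : ℂ)
    simpa using this
  have hker : ∀ (k : ℤ) (s : ℝ), |Real.sinc (Real.pi * (x - k))| /
      ‖(s : ℂ) + y * Complex.I - k‖ ≤
      (2 + |x|) * ((1 / |y| + 1) * (1 + |s|)) * (1 / (1 + |(k : ℝ)|)) ^ 2 := fun k s => by
    have h1 := one_add_abs_mul_abs_sinc_le x k
    have h2 := one_add_abs_le_mul_norm_line_sub hy0 s k
    have hk : 0 < 1 + |(k : ℝ)| := by positivity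
    have hz : 0 < ‖(s : ℂ) + y * Complex.I - k‖ := by
      have := line_sub_ne_zero hy0 s k
      simpa using this
    rw [div_pow, one_pow, mul_one_div, div_le_div_iff₀ hz (by positivity)]
    calc |Real.sinc (Real.pi * (x - k))| * (1 + |(k : ℝ)|) ^ 2
        = ((1 + |(k : ℝ)|) * |Real.sinc (Real.pi * (x - k))|) * (1 + |(k : ℝ)|) := by ring
      _ ≤ (2 + |x|) * ((1 / |y| + 1) * (1 + |s|) * ‖(s : ℂ) + y * Complex.I - k‖) := by gcongr
      _ = _ := by ring
  have hFle : ∀ k s, ‖F k s‖ ≤ (B * ((2 + |x|) * (1 / |y| + 1)) * (1 / (1 + |(k : ℝ)|)) ^ 2) *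
      ((1 + |s|) * Real.exp (-(μ * |s|))) := fun k s => by
    simp only [hF]
    rw [norm_mul, norm_div, Complex.norm_real, Real.norm_eq_abs, div_mul_eq_mul_div,
      mul_div_assoc]
    calc _ ≤ (B * Real.exp (-(μ * |s|))) *
          ((2 + |x|) * ((1 / |y| + 1) * (1 + |s|)) * (1 / (1 + |(k : ℝ)|)) ^ 2) :=
          mul_le_mul (norm_line_le hb hy s) (hker k s) (by positivity) (by positivity)
      _ = _ := by ring
  have hmaj := integrable_one_add_abs_mul_exp_neg_mul_abs hμ
  have hFsum : Summable fun k => ∫ s, ‖F k s‖ := by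
    refine Summable.of_nonneg_of_le (fun k => by positivity)
      (fun k => integral_mono (hFint k).norm (hmaj.const_mul _) (hFle k)) ?_
    simp_rw [integral_const_mul]
    exact (summable_inv_one_add_abs_sq.mul_left _).mul_right _
  have hptwise : ∀ s : ℝ, ∑' k, F k s = g (s + y * Complex.I) / (s + y * Complex.I - x) -
      g (s + y * Complex.I) / Complex.sin (Real.pi * (s + y * Complex.I)) *
          ((Real.sin (Real.pi * x) : ℂ) / (s + y * Complex.I - x)) := by
    intro s
    have hsm : Summable fun k : ℤ => (Real.sinc (Real.pi * (x - k)) : ℂ) /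
        ((s : ℂ) + y * Complex.I - k) := by
      refine Summable.of_norm_bounded
        (summable_inv_one_add_abs_sq.mul_left ((2 + |x|) * ((1 / |y| + 1) * (1 + |s|))))
        fun k => ?_
      rw [norm_div, Complex.norm_real]
      exact hker k s
    have := (hasSum_sinc_div_sub x (z := (s : ℂ) + y * Complex.I) (by simpa using hy0) hsm).mul_left
      (g (s + y * Complex.I))
    have h2 := this.tsum_eq
    rw [show (fun k : ℤ => g (s + y * Complex.I) * ((Real.sinc (Real.pi * (x - k)) : ℂ) /
        ((s : ℂ) + y * Complex.I - k))) = fun k => F k s from by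
      ext k; simp only [hF]; ring] at h2
    rw [h2]
    push_cast
    ring
  have hmain := hasSum_integral_of_summable_integral_norm hFint hFsum
  simp_rw [hptwise] at hmain
  have hsin := fun s => sin_pi_line_ne_zero hy0 s
  have hi2 : Integrable fun s : ℝ =>
      g (s + y * Complex.I) / Complex.sin (Real.pi * (s + y * Complex.I)) *
          ((Real.sin (Real.pi * x) : ℂ) / (s + y * Complex.I - x)) := by
    have hsh : 0 < Real.sinh (Real.pi * |y|) :=
      Real.sinh_pos_iff.mpr (mul_pos Real.pi_pos hy')
    refine ((integrable_line_div_sub hg hμ hb hy hy0 x).norm.mul_const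
      (Real.sinh (Real.pi * |y|))⁻¹).mono' ?_ (Filter.Eventually.of_forall fun s => ?_)
    · exact (((continuous_comp_line hg hy).div (by fun_prop) hsin).mul
        (continuous_const.div (by fun_prop) fun s => line_sub_ne_zero hy0 s x)).aestronglyMeasurable
    · rw [show g (s + y * Complex.I) / Complex.sin (Real.pi * (s + y * Complex.I)) *
          ((Real.sin (Real.pi * x) : ℂ) / (s + y * Complex.I - x)) =
          g (s + y * Complex.I) / (s + y * Complex.I - x) *
          ((Real.sin (Real.pi * x) : ℂ) / Complex.sin (Real.pi * (s + y * Complex.I))) by ring,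
        norm_mul, norm_div (Real.sin (Real.pi * x) : ℂ), Complex.norm_real]
      gcongr
      rw [div_eq_mul_inv]
      calc _ ≤ 1 * (Real.sinh (Real.pi * |y|))⁻¹ := by
            gcongr
            · exact Real.abs_sin_le_one _
            · exact sinh_le_norm_sin_pi_line s y
        _ = _ := one_mul _
  rw [integral_sub (integrable_line_div_sub hg hμ hb hy hy0 x) hi2] at hmain
  refine hmain.congr_fun fun k => ?_
  simp only [hF]
  rw [integral_mul_const]

/-- Fubini moves the oscillatory `x`-integral inside, where it is uniformly bounded; then `|sin πz|
≥ sinh(π|y|)`, and the `L¹` norm of `g` on the line is at most `2B/μ`. -/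
theorem norm_integral_integral_line_le (hg : DifferentiableOn ℂ g (strip d)) (hμ : 0 < μ)
    (hb : ∀ ζ ∈ strip d, ‖g ζ‖ ≤ B * Real.exp (-(μ * |ζ.re|))) {y : ℝ} (hy : |y| < d)
    (hy0 : y ≠ 0) {A ξ : ℝ} (hA : A ≤ ξ) (hcos : Real.cos (Real.pi * A) = 0) :
    IntervalIntegrable (fun x : ℝ => ∫ s : ℝ, g (s + y * Complex.I) /
        Complex.sin (Real.pi * (s + y * Complex.I)) *
          ((Real.sin (Real.pi * x) : ℂ) / (s + y * Complex.I - x))) volume A ξ ∧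
    ‖∫ x in A..ξ, ∫ s : ℝ, g (s + y * Complex.I) /
        Complex.sin (Real.pi * (s + y * Complex.I)) *
          ((Real.sin (Real.pi * x) : ℂ) / (s + y * Complex.I - x))‖ ≤
      2 * B / μ * ((1 / Real.pi + 1) / |y| / Real.sinh (Real.pi * |y|)) := by
  have hB := nonneg_of_strip_bound ((abs_nonneg y).trans_lt hy) hb
  have hy' := abs_pos.mpr hy0
  have hπ := Real.pi_pos
  have hsin := fun s => sin_pi_line_ne_zero hy0 s
  have hsh : 0 < Real.sinh (Real.pi * |y|) := Real.sinh_pos_iff.mpr (mul_pos Real.pi_pos hy')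
  set H : ℝ → ℝ → ℂ := fun x s => g (s + y * Complex.I) /
        Complex.sin (Real.pi * (s + y * Complex.I)) *
          ((Real.sin (Real.pi * x) : ℂ) / (s + y * Complex.I - x)) with hH
  have hgl : ∀ s : ℝ, ‖g (s + y * Complex.I) / Complex.sin (Real.pi * (s + y * Complex.I))‖ ≤
      ‖g (s + y * Complex.I)‖ * (Real.sinh (Real.pi * |y|))⁻¹ := fun s => by
    rw [norm_div, div_eq_mul_inv]
    gcongr
    exact sinh_le_norm_sin_pi_line s y
  have hcont : Continuous (Function.uncurry H) := by
    have h1 : Continuous fun p : ℝ × ℝ => g ((p.2 : ℂ) + y * Complex.I) :=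
      (continuous_comp_line hg hy).comp continuous_snd
    exact (h1.div (by fun_prop) fun p => hsin p.2).mul
      (Continuous.div (by fun_prop) (by fun_prop) fun p => line_sub_ne_zero hy0 p.2 p.1)
  have hprod : Integrable (Function.uncurry H) ((volume.restrict (Set.uIoc A ξ)).prod volume) := by
    have hmaj : Integrable (fun p : ℝ × ℝ => (|y|⁻¹ * (Real.sinh (Real.pi * |y|))⁻¹) *
        ‖g (p.2 + y * Complex.I)‖) ((volume.restrict (Set.uIoc A ξ)).prod volume) := by
      have : IsFiniteMeasure (volume.restrict (Set.uIoc A ξ)) :=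
        ⟨by simp [Set.uIoc]⟩
      exact (integrable_const (μ := volume.restrict (Set.uIoc A ξ)) _).mul_prod (integrable_line hg hμ hb hy).norm
    refine hmaj.mono' hcont.aestronglyMeasurable (Filter.Eventually.of_forall fun p => ?_)
    simp only [Function.uncurry, hH]
    rw [norm_mul, norm_div (Real.sin (Real.pi * p.1) : ℂ), Complex.norm_real]
    calc _ ≤ (‖g (p.2 + y * Complex.I)‖ * (Real.sinh (Real.pi * |y|))⁻¹) * (1 / |y|) := by
          gcongr
          · exact hgl p.2
          · exact Real.abs_sin_le_one _
          · exact abs_le_norm_line_sub p.2 y p.1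
      _ = _ := by ring
  refine ⟨?_, ?_⟩
  · rw [intervalIntegrable_iff]
    exact hprod.integral_prod_left
  · rw [intervalIntegral_integral_swap hprod]
    have hin : ∀ s : ℝ, ‖∫ x in A..ξ, H x s‖ ≤ ‖g (s + y * Complex.I)‖ *
        ((1 / Real.pi + 1) / |y| / Real.sinh (Real.pi * |y|)) := fun s => by
      simp only [hH]
      rw [intervalIntegral.integral_const_mul, norm_mul]
      calc _ ≤ (‖g (s + y * Complex.I)‖ * (Real.sinh (Real.pi * |y|))⁻¹) *
            ((1 / Real.pi + 1) / |y|) :=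
            mul_le_mul (hgl s) (norm_integral_sin_div_line_sub_le hy0 s hA hcos)
              (norm_nonneg _) (by positivity)
        _ = _ := by ring
    calc _ ≤ ∫ s : ℝ, ‖g (s + y * Complex.I)‖ *
        ((1 / Real.pi + 1) / |y| / Real.sinh (Real.pi * |y|)) :=
          norm_integral_le_of_norm_le ((integrable_line hg hμ hb hy).norm.mul_const _)
            (Filter.Eventually.of_forall hin)
      _ ≤ _ := by
          rw [integral_mul_const]
          gcongr
          exact integral_norm_line_le hg hμ hb hy

end Strip

/-! ### Antiderivatives of the sinc functions and their limit at `-∞` -/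

theorem hasDerivAt_sincJ_one (k : ℤ) (x : ℝ) :
    HasDerivAt (sincJ k 1) (Real.sinc (Real.pi * (x - k))) x := by
  have h1 : HasDerivAt (fun x : ℝ => Real.pi * (x / 1 - k)) Real.pi x := by
    simpa using (((hasDerivAt_id x).div_const 1).sub_const (k : ℝ)).const_mul Real.pi
  have h2 := ((((hasDerivAt_sineIntegral _).comp x h1).const_mul (1 / Real.pi)).const_add
    (1 / 2)).const_mul 1
  convert! h2 using 1
  have := Real.pi_ne_zero
  field_simp

theorem integral_sinc_eq_sincJ_sub (k : ℤ) (A ξ : ℝ) :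
    ∫ x in A..ξ, Real.sinc (Real.pi * (x - k)) = sincJ k 1 ξ - sincJ k 1 A :=
  intervalIntegral.integral_eq_sub_of_hasDerivAt (fun x _ => hasDerivAt_sincJ_one k x)
    ((Real.continuous_sinc.comp (by fun_prop)).intervalIntegrable _ _)

open Filter Topology in
theorem tendsto_sincJ_neg_half_integer (k : ℤ) :
    Tendsto (fun m : ℕ => sincJ k 1 (-((m : ℝ) + 1 / 2))) atTop (𝓝 0) := by
  -- The argument of `Si` is `-π(m + k + 1/2)`, and `m + k` is eventually a natural number.
  have hshift : Tendsto (fun m : ℕ => ((m : ℤ) + k).toNat) atTop atTop := by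
    refine tendsto_atTop.mpr fun b => ?_
    filter_upwards [eventually_ge_atTop (b + k.natAbs)] with m hm
    omega
  have h := tendsto_sineIntegral_half_integer.comp hshift
  have h2 : Tendsto (fun m : ℕ => 1 * (1 / 2 + 1 / Real.pi *
      -(sineIntegral (Real.pi * ((((m : ℤ) + k).toNat : ℕ) + 1 / 2))))) atTop
      (𝓝 (1 * (1 / 2 + 1 / Real.pi * -(Real.pi / 2)))) :=
    ((h.neg.const_mul _).const_add _).const_mul _
  have h0 : 1 * (1 / 2 + 1 / Real.pi * -(Real.pi / 2)) = 0 := by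
    have := Real.pi_ne_zero
    field_simp
    ring
  rw [h0] at h2
  refine h2.congr' ?_
  filter_upwards [eventually_ge_atTop k.natAbs] with m hm
  have hc : ((((m : ℤ) + k).toNat : ℕ) : ℝ) = m + k := by
    have : ((((m : ℤ) + k).toNat : ℕ) : ℤ) = m + k := Int.toNat_of_nonneg (by omega)
    exact_mod_cast this
  rw [sincJ, ← sineIntegral_neg, hc]
  congr 4
  ring

/-! ### The discretization error -/

section Strip

variable {g : ℂ → ℂ} {d B μ : ℝ}

theorem norm_int_le (hd : 0 < d) (hb : ∀ ζ ∈ strip d, ‖g ζ‖ ≤ B * Real.exp (-(μ * |ζ.re|)))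
    (x : ℝ) : ‖g x‖ ≤ B * Real.exp (-(μ * |x|)) := by
  simpa using hb x (by simpa [strip] using hd)

theorem summable_norm_int (hd : 0 < d) (hμ : 0 < μ)
    (hb : ∀ ζ ∈ strip d, ‖g ζ‖ ≤ B * Real.exp (-(μ * |ζ.re|))) :
    Summable fun k : ℤ => ‖g k‖ :=
  Summable.of_nonneg_of_le (fun _ => norm_nonneg _)
    (fun k => by simpa using norm_int_le hd hb (k : ℝ))
    ((summable_exp_neg_mul_abs_int hμ).mul_left B)

/-- The remainder of the cardinal series as an integral over the boundary of a strip. -/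
theorem hasSum_cardinalSeries (hg : DifferentiableOn ℂ g (strip d)) (hμ : 0 < μ)
    (hb : ∀ ζ ∈ strip d, ‖g ζ‖ ≤ B * Real.exp (-(μ * |ζ.re|))) {y : ℝ} (hy0 : 0 < y)
    (hy : y < d) (x : ℝ) :
    HasSum (fun k : ℤ => g k * (Real.sinc (Real.pi * (x - k)) : ℂ))
      (g x - (2 * Real.pi * Complex.I)⁻¹ *
        ((∫ s : ℝ, g (s + (-y : ℝ) * Complex.I) /
            Complex.sin (Real.pi * (s + (-y : ℝ) * Complex.I)) *
            ((Real.sin (Real.pi * x) : ℂ) / (s + (-y : ℝ) * Complex.I - x))) -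
          ∫ s : ℝ, g (s + y * Complex.I) / Complex.sin (Real.pi * (s + y * Complex.I)) *
            ((Real.sin (Real.pi * x) : ℂ) / (s + y * Complex.I - x)))) := by
  have hyd : |y| < d := by rwa [abs_of_pos hy0]
  have hyd' : |-y| < d := by rwa [abs_neg]
  have h1 := hasSum_sinc_mul_integral_line hg hμ hb hyd' (neg_ne_zero.mpr hy0.ne') x
  have h2 := hasSum_sinc_mul_integral_line hg hμ hb hyd hy0.ne' x
  have hc : (2 * Real.pi * Complex.I : ℂ) ≠ 0 := by
    simp [Real.pi_ne_zero]
  have h3 := (h1.sub h2).mul_left (2 * Real.pi * Complex.I)⁻¹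
  have hx := cauchy_strip hg hμ hb hy0 hy x
  have hg1 : g x = (2 * Real.pi * Complex.I)⁻¹ * (2 * Real.pi * Complex.I * g x) := by
    field_simp
  -- With `g(x)` and every `g(k)` written as Cauchy integrals, the integrals with kernel `1/(z - x)`
  -- cancel and only those containing `sin πx / sin πz` remain.
  rw [hg1, ← hx, ← mul_sub]
  convert! h3 using 1
  · ext k
    have hk := cauchy_strip hg hμ hb hy0 hy (k : ℝ)
    have hgk : g k = (2 * Real.pi * Complex.I)⁻¹ * (2 * Real.pi * Complex.I * g k) := by
      field_simp
    simp only [Complex.ofReal_intCast] at hk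
    rw [hgk, ← hk]
    ring
  · ring

/-- The cardinal series may be integrated termwise because `Σ ‖g k‖` dominates it. The remainder
consists of two line integrals with prefactor `1/(2π)`, whence the final division by `π`. -/
theorem norm_integral_sub_tsum_sincJ_sub_le (hg : DifferentiableOn ℂ g (strip d)) (hμ : 0 < μ)
    (hb : ∀ ζ ∈ strip d, ‖g ζ‖ ≤ B * Real.exp (-(μ * |ζ.re|))) {y : ℝ} (hy0 : 0 < y)
    (hy : y < d) {A ξ : ℝ} (hA : A ≤ ξ) (hcos : Real.cos (Real.pi * A) = 0) :
    ‖(∫ x in A..ξ, g x) - ∑' k : ℤ, g k * ((sincJ k 1 ξ : ℂ) - sincJ k 1 A)‖ ≤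
      2 * B / μ * ((1 / Real.pi + 1) / y / Real.sinh (Real.pi * y)) / Real.pi := by
  have hπ := Real.pi_pos
  have hd : 0 < d := hy0.trans hy
  have hyd : |y| < d := by rwa [abs_of_pos hy0]
  have hyd' : |-y| < d := by rwa [abs_neg]
  obtain ⟨hi1, hn1⟩ :=
    norm_integral_integral_line_le hg hμ hb hyd' (neg_ne_zero.mpr hy0.ne') hA hcos
  obtain ⟨hi2, hn2⟩ := norm_integral_integral_line_le hg hμ hb hyd hy0.ne' hA hcos
  rw [abs_neg, abs_of_pos hy0] at hn1
  rw [abs_of_pos hy0] at hn2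
  have hsum := summable_norm_int hd hμ hb
  have hseries := intervalIntegral.hasSum_integral_of_dominated_convergence (μ := volume)
    (a := A) (b := ξ)
    (F := fun (k : ℤ) (x : ℝ) => g k * (Real.sinc (Real.pi * (x - k)) : ℂ))
    (fun k _ => ‖g k‖)
    (fun k => by
      refine Continuous.aestronglyMeasurable ?_
      exact continuous_const.mul (Complex.continuous_ofReal.comp
        (Real.continuous_sinc.comp (by fun_prop))))
    (fun k => Filter.Eventually.of_forall fun x _ => by
      rw [norm_mul, Complex.norm_real]
      exact mul_le_of_le_one_right (norm_nonneg _) (Real.abs_sinc_le_one _))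
    (Filter.Eventually.of_forall fun x _ => hsum)
    intervalIntegrable_const
    (Filter.Eventually.of_forall fun x _ => hasSum_cardinalSeries hg hμ hb hy0 hy x)
  have hgi : IntervalIntegrable (fun x : ℝ => g x) volume A ξ := by
    have := continuous_comp_line hg (y := 0) (by simpa using hd)
    simp only [Complex.ofReal_zero, zero_mul, add_zero] at this
    exact this.intervalIntegrable _ _
  have hterm : ∀ k : ℤ, ∫ x in A..ξ, g k * (Real.sinc (Real.pi * (x - k)) : ℂ) =
      g k * ((sincJ k 1 ξ : ℂ) - sincJ k 1 A) := fun k => by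
    rw [intervalIntegral.integral_const_mul, intervalIntegral.integral_ofReal,
      integral_sinc_eq_sincJ_sub, Complex.ofReal_sub]
  simp_rw [hterm] at hseries
  rw [hseries.tsum_eq, intervalIntegral.integral_sub hgi ((hi1.sub hi2).const_mul _),
    sub_sub_cancel, intervalIntegral.integral_const_mul, intervalIntegral.integral_sub hi1 hi2,
    norm_mul, norm_inv]
  have hnc : ‖(2 * Real.pi * Complex.I : ℂ)‖ = 2 * Real.pi := by
    simp [abs_of_pos hπ]
  rw [hnc]
  calc _ ≤ (2 * Real.pi)⁻¹ *
        (2 * B / μ * ((1 / Real.pi + 1) / y / Real.sinh (Real.pi * y)) +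
          2 * B / μ * ((1 / Real.pi + 1) / y / Real.sinh (Real.pi * y))) := by
        gcongr
        exact (norm_sub_le _ _).trans (add_le_add hn1 hn2)
    _ = _ := by field_simp; ring

open Filter Topology in
theorem norm_integral_Iic_sub_tsum_sincJ_le_of_lt (hg : DifferentiableOn ℂ g (strip d))
    (hμ : 0 < μ) (hb : ∀ ζ ∈ strip d, ‖g ζ‖ ≤ B * Real.exp (-(μ * |ζ.re|))) {y : ℝ} (hy0 : 0 < y)
    (hy : y < d) (ξ : ℝ) :
    ‖(∫ x in Set.Iic ξ, g x) - ∑' k : ℤ, g k * (sincJ k 1 ξ : ℂ)‖ ≤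
      2 * B / μ * ((1 / Real.pi + 1) / y / Real.sinh (Real.pi * y)) / Real.pi := by
  have hd : 0 < d := hy0.trans hy
  have hsum := summable_norm_int hd hμ hb
  have hgi : Integrable fun x : ℝ => g x := by
    simpa using integrable_line hg hμ hb (y := 0) (by simpa using hd)
  -- Negative half-integers serve twice: `cos(πA) = 0` there, and `J(k,1)(A) → 0` is known along
  -- them.
  have hA : Tendsto (fun m : ℕ => -((m : ℝ) + 1 / 2)) atTop atBot :=
    tendsto_neg_atTop_atBot.comp
      (tendsto_atTop_add_const_right _ _ tendsto_natCast_atTop_atTop)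
  have h1 := intervalIntegral_tendsto_integral_Iic ξ hgi.integrableOn hA
  have hJ : ∀ (k : ℤ) (x : ℝ), ‖(sincJ k 1 x : ℂ)‖ ≤ 1.1 := fun k x => by
    rw [Complex.norm_real]
    simpa using abs_sincJ_le zero_le_one k x
  have h2 : Tendsto (fun m : ℕ => ∑' k : ℤ, g k *
      ((sincJ k 1 ξ : ℂ) - sincJ k 1 (-((m : ℝ) + 1 / 2)))) atTop
      (𝓝 (∑' k : ℤ, g k * (sincJ k 1 ξ : ℂ))) := by
    refine tendsto_tsum_of_dominated_convergence (hsum.mul_right (1.1 + 1.1)) (fun k => ?_)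
      (Eventually.of_forall fun m k => ?_)
    · have h := (Complex.continuous_ofReal.tendsto 0).comp (tendsto_sincJ_neg_half_integer k)
      simpa using (h.const_sub (sincJ k 1 ξ : ℂ)).const_mul (g k)
    · rw [norm_mul]
      gcongr
      exact (norm_sub_le _ _).trans (add_le_add (hJ k _) (hJ k _))
  refine le_of_tendsto (h1.sub h2).norm ?_
  filter_upwards [hA.eventually (eventually_le_atBot ξ)] with m hm
  refine norm_integral_sub_tsum_sincJ_sub_le hg hμ hb hy0 hy hm ?_
  rw [Real.cos_eq_zero_iff]
  exact ⟨-(m : ℤ) - 1, by push_cast; ring⟩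

open Filter Topology in
/-- The discretization error of the Sinc indefinite integration with unit mesh. -/
theorem norm_integral_Iic_sub_tsum_sincJ_le (hd : 0 < d) (hg : DifferentiableOn ℂ g (strip d))
    (hμ : 0 < μ) (hb : ∀ ζ ∈ strip d, ‖g ζ‖ ≤ B * Real.exp (-(μ * |ζ.re|))) (ξ : ℝ) :
    ‖(∫ x in Set.Iic ξ, g x) - ∑' k : ℤ, g k * (sincJ k 1 ξ : ℂ)‖ ≤
      2 * B / μ * (1 / d) * (Real.exp (-(Real.pi * d)) / (1 - Real.exp (-(2 * (Real.pi * d))))) := by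
  have hπ := Real.pi_pos
  have hB := nonneg_of_strip_bound hd hb
  have hsh : 0 < Real.sinh (Real.pi * d) := Real.sinh_pos_iff.mpr (mul_pos hπ hd)
  have hlim : Tendsto (fun y => 2 * B / μ * ((1 / Real.pi + 1) / y / Real.sinh (Real.pi * y)) /
      Real.pi) (𝓝[<] d) (𝓝 (2 * B / μ * ((1 / Real.pi + 1) / d / Real.sinh (Real.pi * d)) /
      Real.pi)) := by
    refine tendsto_nhdsWithin_of_tendsto_nhds (ContinuousAt.tendsto ?_)
    have hs : ContinuousAt (fun y => Real.sinh (Real.pi * y)) d := by fun_prop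
    exact (continuousAt_const.mul ((continuousAt_const.div continuousAt_id hd.ne').div hs
      hsh.ne')).div_const _
  have hle : ‖(∫ x in Set.Iic ξ, g x) - ∑' k : ℤ, g k * (sincJ k 1 ξ : ℂ)‖ ≤
      2 * B / μ * ((1 / Real.pi + 1) / d / Real.sinh (Real.pi * d)) / Real.pi := by
    -- Nothing is assumed on the boundary of the strip, so the bound is taken for `y < d` and passed
    -- to the limit.
    refine ge_of_tendsto hlim ?_
    filter_upwards [Ioo_mem_nhdsLT hd] with y hy
    exact norm_integral_Iic_sub_tsum_sincJ_le_of_lt hg hμ hb hy.1 hy.2 ξ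
  refine hle.trans ?_
  have hq : Real.exp (-(Real.pi * d)) / (1 - Real.exp (-(2 * (Real.pi * d)))) =
      1 / (2 * Real.sinh (Real.pi * d)) := by
    have h1 : 1 - Real.exp (-(2 * (Real.pi * d))) =
        Real.exp (-(Real.pi * d)) * (2 * Real.sinh (Real.pi * d)) := by
      rw [Real.sinh_eq, show -(2 * (Real.pi * d)) = -(Real.pi * d) + -(Real.pi * d) by ring,
        Real.exp_add, Real.exp_neg]
      have := Real.exp_pos (Real.pi * d)
      field_simp
    rw [h1]
    have := Real.exp_pos (-(Real.pi * d))
    field_simp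
  rw [hq]
  -- The numerical constant, about `0.42`, is rounded up to `1/2`, so that `1/(2 sinh πd)` appears,
  -- which equals the stated exponential quotient.
  have hnum : (1 / Real.pi + 1) / Real.pi ≤ 1 / 2 := by
    rw [div_add_one hπ.ne', div_div, div_le_div_iff₀ (by positivity) two_pos]
    nlinarith [Real.pi_gt_three]
  calc 2 * B / μ * ((1 / Real.pi + 1) / d / Real.sinh (Real.pi * d)) / Real.pi
      = 2 * B / μ * (1 / d) * (1 / Real.sinh (Real.pi * d)) * ((1 / Real.pi + 1) / Real.pi) := by
        field_simp
    _ ≤ 2 * B / μ * (1 / d) * (1 / Real.sinh (Real.pi * d)) * (1 / 2) := by gcongr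
    _ = _ := by field_simp

theorem integral_comp_mul_right_Iic (f : ℝ → ℂ) (a : ℝ) {b : ℝ} (hb : 0 < b) :
    ∫ x in Set.Iic a, f (x * b) = b⁻¹ • ∫ x in Set.Iic (a * b), f x := by
  have h1 := integral_comp_neg_Iic a fun x => f (-(x * b))
  have h2 := integral_comp_neg_Iic (a * b) fun x => f (-x)
  simp only [neg_mul, neg_neg] at h1 h2
  rw [h1, h2, integral_comp_mul_right_Ioi (fun x => f (-x)) (-a) hb, neg_mul]

/-- The discretization error of the Sinc indefinite integration. -/
theorem norm_integral_Iic_sub_tsum_sincJ_mesh_le (hd : 0 < d)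
    (hg : DifferentiableOn ℂ g (strip d))
    (hμ : 0 < μ) (hb : ∀ ζ ∈ strip d, ‖g ζ‖ ≤ B * Real.exp (-(μ * |ζ.re|))) {h : ℝ} (hh : 0 < h)
    (ξ : ℝ) :
    ‖(∫ x in Set.Iic ξ, g x) - ∑' k : ℤ, g (k * h : ℝ) * (sincJ k h ξ : ℂ)‖ ≤
      2 * B / μ * (h / d) *
        (Real.exp (-(Real.pi * d / h)) / (1 - Real.exp (-(2 * (Real.pi * d / h))))) := by
  -- Rescaling to unit mesh replaces `d` by `d/h` and `μ` by `μh`, while the integral and the basis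
  -- functions both gain a factor `h`.
  set G : ℂ → ℂ := fun ζ => g (ζ * h) with hG
  have hmap : ∀ ζ ∈ strip (d / h), ζ * h ∈ strip d := fun ζ hζ => by
    simp only [strip, Set.mem_ofPred_eq] at hζ ⊢
    rw [Complex.im_mul_ofReal, abs_mul, abs_of_pos hh]
    rwa [lt_div_iff₀ hh] at hζ
  have hGd : DifferentiableOn ℂ G (strip (d / h)) :=
    hg.comp (by fun_prop) hmap
  have hGb : ∀ ζ ∈ strip (d / h), ‖G ζ‖ ≤ B * Real.exp (-(μ * h * |ζ.re|)) := fun ζ hζ => by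
    have := hb _ (hmap ζ hζ)
    rwa [Complex.re_mul_ofReal, abs_mul, abs_of_pos hh, mul_comm |ζ.re|, ← mul_assoc] at this
  have hmain := norm_integral_Iic_sub_tsum_sincJ_le (div_pos hd hh) hGd (mul_pos hμ hh) hGb (ξ / h)
  have hint : (∫ x in Set.Iic ξ, g x) = h * ∫ x in Set.Iic (ξ / h), G x := by
    have := integral_comp_mul_right_Iic (fun x : ℝ => g x) (ξ / h) hh
    rw [div_mul_cancel₀ _ hh.ne'] at this
    simp only [hG]
    push_cast at this
    rw [this, Complex.real_smul, ← mul_assoc]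
    push_cast
    rw [mul_inv_cancel₀ (by exact_mod_cast hh.ne'), one_mul]
  have hJ : ∀ k : ℤ, sincJ k h ξ = h * sincJ k 1 (ξ / h) := fun k => by
    simp only [sincJ, div_one, one_mul]
  have hsum : ∑' k : ℤ, g (k * h : ℝ) * (sincJ k h ξ : ℂ) =
      h * ∑' k : ℤ, G k * (sincJ k 1 (ξ / h) : ℂ) := by
    rw [← tsum_mul_left]
    congr 1
    ext k
    rw [hJ]
    simp only [hG]
    push_cast
    ring
  rw [hint, hsum, ← mul_sub, norm_mul, Complex.norm_real, Real.norm_of_nonneg hh.le]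
  calc _ ≤ h * _ := mul_le_mul_of_nonneg_left hmain hh.le
    _ = _ := by
      rw [← mul_div_assoc]
      field_simp

end Strip

/-! ### The truncation error -/

theorem hasSum_exp_tail (N : ℕ) {c : ℝ} (hc : 0 < c) :
    HasSum (fun k : ℤ => if (N : ℤ) < k then Real.exp (-(c * k)) else 0)
      (Real.exp (-(c * N)) / (Real.exp c - 1)) := by
  have hinj : Function.Injective fun j : ℕ => (N : ℤ) + 1 + j := fun a b h => by
    simpa using h
  rw [← hinj.hasSum_iff]
  · have hgeo := (hasSum_geometric_of_lt_one (Real.exp_pos (-c)).le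
      (Real.exp_lt_one_iff.mpr (neg_lt_zero.mpr hc))).mul_left (Real.exp (-(c * (N + 1))))
    have hv : Real.exp (-(c * (N + 1))) * (1 - Real.exp (-c))⁻¹ =
        Real.exp (-(c * N)) / (Real.exp c - 1) := by
      have h1 : 1 < Real.exp c := Real.one_lt_exp_iff.mpr hc
      have h2 : Real.exp c - 1 ≠ 0 := by linarith
      have h3 : 1 - (Real.exp c)⁻¹ ≠ 0 := by
        have := inv_lt_one_of_one_lt₀ h1
        linarith
      rw [show -(c * (N + 1 : ℝ)) = -(c * N) + -c by ring, Real.exp_add, Real.exp_neg c]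
      field_simp
    rw [hv] at hgeo
    convert! hgeo using 1
    ext j
    have : (N : ℤ) < (N : ℤ) + 1 + j := by omega
    simp only [Function.comp_apply, this, if_true]
    rw [← Real.exp_nat_mul, ← Real.exp_add]
    push_cast
    ring_nf
  · intro k hk
    rw [if_neg]
    intro h
    exact hk ⟨(k - (N + 1)).toNat, by simp only; omega⟩

/-- Applied with `c = αh` and `c = βh`: the resulting `1/h` cancels the `h` in `|J| ≤ 1.1 h`. -/
theorem exp_tail_le (N : ℕ) {c : ℝ} (hc : 0 < c) :
    Real.exp (-(c * N)) / (Real.exp c - 1) ≤ Real.exp (-(c * N)) / c := by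
  gcongr
  linarith [Real.add_one_le_exp c]

/-- The truncation error of a two-sided series with exponentially decaying terms. -/
theorem norm_tsum_sub_sum_Icc_le {a : ℤ → ℂ} (ha : Summable a) {C p q : ℝ} (hp : 0 < p)
    (hq : 0 < q) (hC : 0 ≤ C) (h1 : ∀ k, ‖a k‖ ≤ C * Real.exp (-(q * k)))
    (h2 : ∀ k, ‖a k‖ ≤ C * Real.exp (p * k)) (M N : ℕ) :
    ‖∑' k, a k - ∑ k ∈ Finset.Icc (-(M : ℤ)) N, a k‖ ≤
      C * (Real.exp (-(q * N)) / q + Real.exp (-(p * M)) / p) := by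
  have hfin : HasSum (fun k => if k ∈ Finset.Icc (-(M : ℤ)) N then a k else 0)
      (∑ k ∈ Finset.Icc (-(M : ℤ)) N, a k) := by
    rw [← Finset.sum_congr rfl fun k hk => if_pos hk]
    exact hasSum_sum_of_ne_finset_zero fun k hk => if_neg hk
  have hdiff := ha.hasSum.sub hfin
  have hu := hasSum_exp_tail N hq
  have hl := (Equiv.neg ℤ).hasSum_iff.mpr (hasSum_exp_tail M hp)
  have hbd := (hu.add hl).mul_left C
  rw [← hdiff.tsum_eq]
  refine (tsum_of_norm_bounded hbd fun k => ?_).trans ?_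
  · simp only [Function.comp_apply, Equiv.neg_apply]
    split_ifs with hk hN hM hM hN hM hM
    · rw [Finset.mem_Icc] at hk; omega
    · rw [Finset.mem_Icc] at hk; omega
    · rw [Finset.mem_Icc] at hk; omega
    · simp
    · omega
    · simpa using h1 k
    · have := h2 k
      push_cast
      simpa using this
    · rw [Finset.mem_Icc] at hk; omega
  · exact mul_le_mul_of_nonneg_left (add_le_add (exp_tail_le N hq) (exp_tail_le M hp)) hC

/-! ### Balancing mesh size and truncation numbers -/

section Mesh

variable {d α β : ℝ} {n : ℕ}

theorem meshSize_pos (hd : 0 < d) (hα : 0 < α) (hβ : 0 < β) (hn : 0 < n) :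
    0 < meshSize d α β n := by
  have := Real.pi_pos
  have := lt_min hα hβ
  have : (0 : ℝ) < n := by exact_mod_cast hn
  exact Real.sqrt_pos.mpr (by positivity)

theorem meshSize_sq (hd : 0 < d) (hα : 0 < α) (hβ : 0 < β) :
    meshSize d α β n ^ 2 = Real.pi * d / (min α β * n) := by
  have := Real.pi_pos
  have := lt_min hα hβ
  exact Real.sq_sqrt (by positivity)

/-- With the next lemma, the reason for the choice of `h`: the discretization exponent `πd/h` and
the truncation exponent `μnh` coincide. -/
theorem pi_mul_div_meshSize (hd : 0 < d) (hα : 0 < α) (hβ : 0 < β) (hn : 0 < n) :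
    Real.pi * d / meshSize d α β n = Real.sqrt (Real.pi * d * min α β * n) := by
  have hh := meshSize_pos hd hα hβ hn
  have hπ := Real.pi_pos
  have hμ := lt_min hα hβ
  have hn' : (0 : ℝ) < n := by exact_mod_cast hn
  symm
  rw [Real.sqrt_eq_iff_mul_self_eq (by positivity) (by positivity), ← sq, div_pow,
    meshSize_sq hd hα hβ]
  field_simp

theorem min_mul_mul_meshSize (hd : 0 < d) (hα : 0 < α) (hβ : 0 < β) (hn : 0 < n) :
    min α β * n * meshSize d α β n = Real.sqrt (Real.pi * d * min α β * n) := by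
  have hh := meshSize_pos hd hα hβ hn
  have hμ := lt_min hα hβ
  have hn' : (0 : ℝ) < n := by exact_mod_cast hn
  rw [← pi_mul_div_meshSize hd hα hβ hn, eq_div_iff hh.ne', mul_assoc, ← sq, meshSize_sq hd hα hβ]
  field_simp

theorem meshSize_div_le (hd : 0 < d) (hα : 0 < α) (hβ : 0 < β) (hn : 0 < n) :
    meshSize d α β n / d ≤ Real.sqrt (Real.pi / (d * min α β)) := by
  have hπ := Real.pi_pos
  have hμ := lt_min hα hβ
  have hn' : (1 : ℝ) ≤ n := by exact_mod_cast hn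
  refine Real.le_sqrt_of_sq_le ?_
  rw [div_pow, meshSize_sq hd hα hβ, div_div, div_le_div_iff₀ (by positivity) (by positivity)]
  have : 0 ≤ Real.pi * d * d * min α β * (n - 1) := by
    have : (0 : ℝ) ≤ n - 1 := by linarith
    positivity
  nlinarith

/-- The ceilings are chosen so that `βN` and `αM` both reach `μn`; neither tail is then slower than
the balanced rate. -/
theorem min_mul_le_mul_truncN (hβ : 0 < β) :
    min α β * n ≤ β * truncN α β n := by
  unfold truncN
  split_ifs with h
  · rw [h]
    have := Nat.le_ceil (α * n / β)
    rw [div_le_iff₀ hβ] at this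
    linarith
  · have : min α β = β := (min_choice α β).resolve_left h
    rw [this]

theorem min_mul_le_mul_truncM (hα : 0 < α) :
    min α β * n ≤ α * truncM α β n := by
  unfold truncM
  split_ifs with h
  · rw [h]
  · have hβ : min α β = β := (min_choice α β).resolve_left h
    rw [hβ]
    have := Nat.le_ceil (β * n / α)
    rw [div_le_iff₀ hα] at this
    linarith

/-- The total error of the truncated Sinc indefinite integration of a function which decays
exponentially on a strip. -/
theorem norm_integral_Iic_sub_sum_sincJ_le {g : ℂ → ℂ} {B B₀ : ℝ} (hd : 0 < d) (hα : 0 < α)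
    (hβ : 0 < β) (hn : 0 < n) (hg : DifferentiableOn ℂ g (strip d))
    (hb : ∀ ζ ∈ strip d, ‖g ζ‖ ≤ B * Real.exp (-(min α β * |ζ.re|)))
    (hα' : ∀ x : ℝ, ‖g x‖ ≤ B₀ * Real.exp (α * x))
    (hβ' : ∀ x : ℝ, ‖g x‖ ≤ B₀ * Real.exp (-(β * x))) (ξ : ℝ) :
    ‖(∫ x in Set.Iic ξ, g x) - ∑ k ∈ Finset.Icc (-(truncM α β n : ℤ)) (truncN α β n : ℤ),
      g ((k : ℝ) * meshSize d α β n : ℝ) * (sincJ k (meshSize d α β n) ξ : ℂ)‖ ≤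
    2 / min α β * (B / (1 - Real.exp (-(2 * Real.sqrt (Real.pi * d * min α β)))) *
        Real.sqrt (Real.pi / (d * min α β)) + 1.1 * B₀) *
      Real.exp (-Real.sqrt (Real.pi * d * min α β * n)) := by
  have hπ := Real.pi_pos
  have hμ := lt_min hα hβ
  have hn' : (1 : ℝ) ≤ n := by exact_mod_cast hn
  have hB := nonneg_of_strip_bound hd hb
  have hB₀ : 0 ≤ B₀ := by simpa using (norm_nonneg _).trans (hα' 0)
  have hh := meshSize_pos hd hα hβ hn
  have hdisc := norm_integral_Iic_sub_tsum_sincJ_mesh_le hd hg hμ hb hh ξ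
  have hw1 := pi_mul_div_meshSize hd hα hβ hn
  have hw2 := min_mul_mul_meshSize hd hα hβ hn
  rw [hw1] at hdisc
  set h := meshSize d α β n with hhdef
  set E := Real.sqrt (Real.pi * d * min α β * n) with hE
  have hE1 : Real.sqrt (Real.pi * d * min α β) ≤ E := by
    refine Real.sqrt_le_sqrt (le_mul_of_one_le_right (by positivity) hn')
  have hE0 : 0 < Real.sqrt (Real.pi * d * min α β) := Real.sqrt_pos.mpr (by positivity)
  have hden : 0 < 1 - Real.exp (-(2 * Real.sqrt (Real.pi * d * min α β))) := by
    have : Real.exp (-(2 * Real.sqrt (Real.pi * d * min α β))) < 1 :=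
      Real.exp_lt_one_iff.mpr (by linarith)
    linarith
  have hdisc' : ‖(∫ x in Set.Iic ξ, g x) - ∑' k : ℤ, g (k * h : ℝ) * (sincJ k h ξ : ℂ)‖ ≤
      2 * B / min α β * Real.sqrt (Real.pi / (d * min α β)) * (Real.exp (-E) /
        (1 - Real.exp (-(2 * Real.sqrt (Real.pi * d * min α β))))) := by
    refine hdisc.trans ?_
    -- Both `h/d` and the reciprocal of `1 - exp(-2πd/h)` are largest at `n = 1`, which makes the
    -- constant independent of `n`.
    have hmesh : h / d ≤ _ := meshSize_div_le hd hα hβ hn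
    have hden' : 1 - Real.exp (-(2 * Real.sqrt (Real.pi * d * min α β))) ≤
        1 - Real.exp (-(2 * E)) := by gcongr
    have := hden.trans_le hden'
    gcongr
  have hgexp : ∀ k : ℤ, ‖g (k * h : ℝ) * (sincJ k h ξ : ℂ)‖ ≤ ‖g (k * h : ℝ)‖ * (1.1 * h) :=
    fun k => by
      rw [norm_mul, Complex.norm_real]
      gcongr
      exact abs_sincJ_le hh.le k ξ
  have hsum : Summable fun k : ℤ => g (k * h : ℝ) * (sincJ k h ξ : ℂ) := by
    refine Summable.of_norm_bounded (((summable_exp_neg_mul_abs_int (mul_pos hμ hh)).mul_left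
      B).mul_right (1.1 * h)) fun k => (hgexp k).trans ?_
    gcongr
    have := norm_int_le hd hb (k * h)
    rwa [abs_mul, abs_of_pos hh, mul_comm |(k : ℝ)|, ← mul_assoc] at this
  -- Only real samples enter here, so the constant `B₀` replaces the strip constant `B`, and the two
  -- tails keep their own rates `α` and `β`.
  have htrunc := norm_tsum_sub_sum_Icc_le hsum (C := B₀ * (1.1 * h)) (mul_pos hα hh)
    (mul_pos hβ hh) (by positivity)
    (fun k => (hgexp k).trans (by
      rw [mul_right_comm]
      gcongr
      have := hβ' (k * h)
      rwa [show β * (k * h) = β * h * k by ring] at this))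
    (fun k => (hgexp k).trans (by
      rw [mul_right_comm]
      gcongr
      have := hα' (k * h)
      rwa [show α * (k * h) = α * h * k by ring] at this))
    (truncM α β n) (truncN α β n)
  have hN : Real.exp (-(β * h * truncN α β n)) / (β * h) ≤
      Real.exp (-E) / (min α β * h) := by
    have h1 := min_mul_le_mul_truncN (n := n) (α := α) hβ
    have h2 : E ≤ β * h * truncN α β n := by
      rw [← hw2, mul_right_comm _ h]
      exact mul_le_mul_of_nonneg_right h1 hh.le
    gcongr
    exact min_le_right _ _
  have hM : Real.exp (-(α * h * truncM α β n)) / (α * h) ≤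
      Real.exp (-E) / (min α β * h) := by
    have h1 := min_mul_le_mul_truncM (n := n) (β := β) hα
    have h2 : E ≤ α * h * truncM α β n := by
      rw [← hw2, mul_right_comm _ h]
      exact mul_le_mul_of_nonneg_right h1 hh.le
    gcongr
    exact min_le_left _ _
  have htrunc' := htrunc.trans (mul_le_mul_of_nonneg_left (add_le_add hN hM) (by positivity))
  have htri := norm_sub_le_norm_sub_add_norm_sub (∫ x in Set.Iic ξ, g x)
    (∑' k : ℤ, g (k * h : ℝ) * (sincJ k h ξ : ℂ))
    (∑ k ∈ Finset.Icc (-(truncM α β n : ℤ)) (truncN α β n : ℤ),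
      g (k * h : ℝ) * (sincJ k h ξ : ℂ))
  refine htri.trans ((add_le_add hdisc' htrunc').trans (le_of_eq ?_))
  field_simp
  ring

end Mesh

/-! ### Change of variables -/

/-- Sinc indefinite integration after a change of variables `ψ`. -/
theorem sincIndef_error_le {ψ f : ℂ → ℂ} {p p' : ℝ → ℝ} {d α β B B₀ ξ τ : ℝ} {n : ℕ}
    (hd : 0 < d) (hα : 0 < α) (hβ : 0 < β) (hn : 0 < n) (hψ : DifferentiableOn ℂ ψ (strip d))
    (hf : AnalyticOnNhd ℂ f (ψ '' strip d)) (hp : ∀ x : ℝ, ψ x = p x)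
    (hp' : ∀ x : ℝ, deriv ψ x = p' x) (hpd : ∀ x, HasDerivAt p (p' x) x) (hmono : Monotone p)
    (hτ : 0 ≤ τ) (himage : p '' Set.Iic ξ = Set.Ioc 0 τ)
    (hb : ∀ ζ ∈ strip d, ‖f (ψ ζ) * deriv ψ ζ‖ ≤ B * Real.exp (-(min α β * |ζ.re|)))
    (hα' : ∀ x : ℝ, ‖f (p x) * p' x‖ ≤ B₀ * Real.exp (α * x))
    (hβ' : ∀ x : ℝ, ‖f (p x) * p' x‖ ≤ B₀ * Real.exp (-(β * x))) :
    IntervalIntegrable (fun t : ℝ => f (t : ℂ)) volume 0 τ ∧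
    ‖(∫ t in (0 : ℝ)..τ, f (t : ℂ)) - sincIndef ψ f d α β n ξ‖ ≤
      2 / min α β * (B / (1 - Real.exp (-(2 * Real.sqrt (Real.pi * d * min α β)))) *
        Real.sqrt (Real.pi / (d * min α β)) + 1.1 * B₀) *
      Real.exp (-Real.sqrt (Real.pi * d * min α β * n)) := by
  have hμ := lt_min hα hβ
  set g : ℂ → ℂ := fun ζ => f (ψ ζ) * deriv ψ ζ with hg
  have hψa : AnalyticOnNhd ℂ ψ (strip d) := hψ.analyticOnNhd (isOpen_strip d)
  have hgd : DifferentiableOn ℂ g (strip d) :=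
    ((hf.comp hψa (Set.mapsTo_image ψ _)).mul hψa.deriv).differentiableOn
  have hgx : ∀ x : ℝ, g x = f (p x) * p' x := fun x => by simp only [hg, hp, hp']
  have hgi : Integrable fun x : ℝ => g x := by
    simpa using integrable_line hgd hμ hb (y := 0) (by simpa using hd)
  have hsm : ∀ x : ℝ, g x = p' x • f (p x) := fun x => by
    rw [hgx, Complex.real_smul, mul_comm]
  have hcv := integral_image_eq_integral_deriv_smul_of_monotoneOn (measurableSet_Iic (a := ξ))
    (fun x _ => (hpd x).hasDerivWithinAt) (hmono.monotoneOn _) (fun t : ℝ => f t)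
  have hci := integrableOn_image_iff_integrableOn_deriv_smul_of_monotoneOn
    (measurableSet_Iic (a := ξ))
    (fun x _ => (hpd x).hasDerivWithinAt) (hmono.monotoneOn _) (fun t : ℝ => f t)
  simp_rw [← hsm, himage] at hcv hci
  refine ⟨(intervalIntegrable_iff_integrableOn_Ioc_of_le hτ).mpr (hci.mpr hgi.integrableOn), ?_⟩
  rw [intervalIntegral.integral_of_le hτ, hcv]
  exact norm_integral_Iic_sub_sum_sincJ_le hd hα hβ hn hgd hb
    (fun x => by rw [hgx]; exact hα' x) (fun x => by rw [hgx]; exact hβ' x) ξ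

/-! ### Sector estimates and case 2 -/

theorem sector_le_norm_one_add_sq {w : ℂ} {c : ℝ} (hc0 : 0 ≤ c) (hc1 : c ≤ 1)
    (hw : c * ‖w‖ ≤ w.re) : c * (1 + ‖w‖ ^ 2) ≤ ‖1 + w ^ 2‖ := by
  have h1 : ‖1 + w ^ 2‖ ^ 2 = (1 + ‖w‖ ^ 2) ^ 2 - 4 * w.im ^ 2 := by
    rw [← Complex.normSq_eq_norm_sq, ← Complex.normSq_eq_norm_sq, Complex.normSq_apply,
      Complex.normSq_apply]
    simp [pow_two]
    ring
  have h2 : ‖w‖ ^ 2 = w.re ^ 2 + w.im ^ 2 := by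
    rw [← Complex.normSq_eq_norm_sq, Complex.normSq_apply]
    ring
  refine abs_le_of_sq_le_sq' ?_ (norm_nonneg _) |>.2
  rw [h1]
  have h3 : (c * ‖w‖) ^ 2 ≤ w.re ^ 2 := by gcongr
  -- Since `(Im w)² ≤ (1 - c²)‖w‖²`, the gap between the two squared sides is at least `(1 - c²)((1
  -- + ‖w‖²)² - 4‖w‖²)`, which is this product.
  have h4 : 0 ≤ (1 - c ^ 2) * (1 - ‖w‖ ^ 2) ^ 2 :=
    mul_nonneg (by nlinarith) (sq_nonneg _)
  nlinarith

theorem cos_mul_norm_exp_le {d : ℝ} (hd' : d < Real.pi / 2) {ζ : ℂ}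
    (hζ : ζ ∈ strip d) : Real.cos d * ‖Complex.exp ζ‖ ≤ (Complex.exp ζ).re := by
  have h1 : Real.cos d ≤ Real.cos ζ.im := by
    rw [← Real.cos_abs ζ.im]
    exact Real.cos_le_cos_of_nonneg_of_le_pi (abs_nonneg _) (by linarith [Real.pi_pos]) hζ.le
  rw [Complex.norm_exp, Complex.exp_re, mul_comm]
  gcongr

theorem exp_rpow_div_le (x : ℝ) {α β : ℝ} (hα : 0 < α) (hβ : 0 < β) :
    Real.exp x ^ α / (1 + Real.exp x ^ 2) ^ ((α + β) / 2) ≤ Real.exp (α * x) ∧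
    Real.exp x ^ α / (1 + Real.exp x ^ 2) ^ ((α + β) / 2) ≤ Real.exp (-(β * x)) := by
  have hE : Real.exp x ^ α = Real.exp (α * x) := by rw [← Real.exp_mul, mul_comm]
  have h2 : Real.exp ((α + β) * x) ≤ (1 + Real.exp x ^ 2) ^ ((α + β) / 2) := by
    calc Real.exp ((α + β) * x) = (Real.exp x ^ 2) ^ ((α + β) / 2) := by
          rw [← Real.exp_nat_mul, ← Real.exp_mul]; push_cast; ring_nf
      _ ≤ _ := by gcongr; linarith
  have h1 : 1 ≤ (1 + Real.exp x ^ 2) ^ ((α + β) / 2) :=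
    Real.one_le_rpow (by linarith [sq_nonneg (Real.exp x)]) (by positivity)
  rw [hE]
  refine ⟨div_le_self (Real.exp_pos _).le h1, ?_⟩
  rw [div_le_iff₀ (by linarith)]
  calc Real.exp (α * x) = Real.exp (-(β * x)) * Real.exp ((α + β) * x) := by
        rw [← Real.exp_add]; ring_nf
    _ ≤ _ := by gcongr

theorem exp_rpow_div_le_exp_neg_min (x : ℝ) {α β : ℝ} (hα : 0 < α) (hβ : 0 < β) :
    Real.exp x ^ α / (1 + Real.exp x ^ 2) ^ ((α + β) / 2) ≤
      Real.exp (-(min α β * |x|)) := by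
  obtain ⟨h1, h2⟩ := exp_rpow_div_le x hα hβ
  rcases le_total 0 x with hx | hx
  · refine h2.trans (Real.exp_le_exp.mpr ?_)
    rw [abs_of_nonneg hx]
    have := min_le_right α β
    nlinarith
  · refine h1.trans (Real.exp_le_exp.mpr ?_)
    rw [abs_of_nonpos hx]
    have := min_le_left α β
    nlinarith

theorem norm_E₂_mul_le {w : ℂ} {c α β : ℝ} (hw0 : w ≠ 0) (hc0 : 0 < c) (hc1 : c ≤ 1)
    (hw : c * ‖w‖ ≤ w.re) (hα : 0 < α) (hβ : 0 < β) :
    ‖E₂ w α β‖ * ‖w‖ ≤ 1 / c ^ ((α + β) / 2) *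
      (‖w‖ ^ α / (1 + ‖w‖ ^ 2) ^ ((α + β) / 2)) := by
  have hr : 0 < ‖w‖ := norm_pos_iff.mpr hw0
  have h := sector_le_norm_one_add_sq hc0.le hc1 hw
  rw [E₂, norm_div, Complex.norm_cpow_real, Complex.norm_cpow_real, div_mul_eq_mul_div,
    Real.rpow_sub_one hr.ne', div_mul_cancel₀ _ hr.ne', div_mul_div_comm, one_mul,
    ← Real.mul_rpow hc0.le (by positivity)]
  gcongr

/-- The free parameter `c` serves two purposes: `c = cos d` gives the bound on the strip, `c = 1`
the sharper one at the real samples. -/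
theorem norm_comp_exp_mul_le {f : ℂ → ℂ} {K α β c : ℝ} {ζ : ℂ} (hK : 0 < K) (hα : 0 < α)
    (hβ : 0 < β) (hc0 : 0 < c) (hc1 : c ≤ 1)
    (hw : c * ‖Complex.exp ζ‖ ≤ (Complex.exp ζ).re)
    (hf : ‖f (Complex.exp ζ)‖ ≤ K * ‖E₂ (Complex.exp ζ) α β‖) :
    ‖f (Complex.exp ζ) * Complex.exp ζ‖ ≤ K / c ^ ((α + β) / 2) *
      (Real.exp ζ.re ^ α / (1 + Real.exp ζ.re ^ 2) ^ ((α + β) / 2)) := by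
  have h := norm_E₂_mul_le (Complex.exp_ne_zero ζ) hc0 hc1 hw hα hβ
  rw [norm_mul]
  calc _ ≤ K * ‖E₂ (Complex.exp ζ) α β‖ * ‖Complex.exp ζ‖ := by gcongr
    _ = K * (‖E₂ (Complex.exp ζ) α β‖ * ‖Complex.exp ζ‖) := by ring
    _ ≤ K * _ := mul_le_mul_of_nonneg_left h hK.le
    _ = _ := by rw [Complex.norm_exp]; ring

theorem sincIndef_seMap₂_error_le {f : ℂ → ℂ} {d K α β : ℝ} {n : ℕ}
    (hd : 0 < d) (hd' : d < Real.pi / 2) (hK : 0 < K) (hα : 0 < α) (hβ : 0 < β) (hn : 0 < n)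
    (hf : AnalyticOnNhd ℂ f (seMap₂ '' strip d))
    (hb : ∀ z ∈ seMap₂ '' strip d, ‖f z‖ ≤ K * ‖E₂ z α β‖) {τ : ℝ} (hτ : 0 < τ) :
    IntervalIntegrable (fun t : ℝ => f (t : ℂ)) volume 0 τ ∧
    ‖(∫ t in (0 : ℝ)..τ, f (t : ℂ)) - sincIndef seMap₂ f d α β n (seInv₂ τ)‖ ≤
      constC₂ K d α β * Real.exp (-Real.sqrt (Real.pi * d * min α β * n)) := by
  have hcos : 0 < Real.cos d := Real.cos_pos_of_mem_Ioo ⟨by linarith, hd'⟩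
  have hderiv : ∀ ζ, deriv seMap₂ ζ = Complex.exp ζ := fun ζ =>
    (Complex.hasDerivAt_exp ζ).deriv
  have hreal : ∀ x : ℝ, ‖f (Real.exp x : ℝ) * (Real.exp x : ℝ)‖ ≤ K *
      (Real.exp x ^ α / (1 + Real.exp x ^ 2) ^ ((α + β) / 2)) := fun x => by
    have hx : (x : ℂ) ∈ strip d := by simpa [strip] using hd
    have := norm_comp_exp_mul_le (ζ := x) (c := 1) hK hα hβ one_pos le_rfl
      (by rw [← Complex.ofReal_exp, Complex.norm_real, Complex.ofReal_re,
        Real.norm_of_nonneg (Real.exp_pos x).le, one_mul]) (hb _ ⟨x, hx, rfl⟩)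
    simpa using this
  have himage : Real.exp '' Set.Iic (seInv₂ τ) = Set.Ioc 0 τ := by
    ext t
    constructor
    · rintro ⟨x, hx, rfl⟩
      exact ⟨Real.exp_pos x, (Real.le_log_iff_exp_le hτ).mp hx⟩
    · rintro ⟨h0, h1⟩
      exact ⟨Real.log t, Real.log_le_log h0 h1, Real.exp_log h0⟩
  have hmain := sincIndef_error_le (n := n) hd hα hβ hn (ψ := seMap₂) (f := f) (p := Real.exp)
    (p' := Real.exp) Complex.differentiable_exp.differentiableOn hf seMap₂_ofReal
    (fun x => by rw [hderiv, Complex.ofReal_exp]) Real.hasDerivAt_exp Real.exp_monotone hτ.le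
    himage (B := K / Real.cos d ^ ((α + β) / 2)) (B₀ := K)
    (fun ζ hζ => by
      rw [hderiv]
      exact (norm_comp_exp_mul_le hK hα hβ hcos (Real.cos_le_one d) (cos_mul_norm_exp_le hd' hζ)
        (hb _ ⟨ζ, hζ, rfl⟩)).trans (mul_le_mul_of_nonneg_left
          (exp_rpow_div_le_exp_neg_min _ hα hβ) (by positivity)))
    (fun x => (hreal x).trans (mul_le_mul_of_nonneg_left (exp_rpow_div_le x hα hβ).1 hK.le))
    (fun x => (hreal x).trans (mul_le_mul_of_nonneg_left (exp_rpow_div_le x hα hβ).2 hK.le))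
  refine ⟨hmain.1, hmain.2.trans (le_of_eq ?_)⟩
  rw [constC₂]
  congr 1
  have := lt_min hα hβ
  rw [mul_comm (1 - Real.exp _)]
  simp only [div_eq_mul_inv, mul_inv]
  ring

/-! ### Case 3: `arcsinh` on a sector -/

/-- The principal branch of `√(1 + w²)`. -/
def sqrtOneAddSq (w : ℂ) : ℂ := (1 + w ^ 2) ^ (1 / 2 : ℂ)

theorem carcsinh_eq (w : ℂ) : carcsinh w = Complex.log (w + sqrtOneAddSq w) := rfl

section Sector

variable {w : ℂ} {c : ℝ}

theorem re_nonneg_of_sector (hc : 0 < c) (hw : c * ‖w‖ ≤ w.re) : 0 ≤ w.re :=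
  (by positivity : 0 ≤ c * ‖w‖).trans hw

theorem one_add_sq_mem_slitPlane (hc : 0 < c) (hw : c * ‖w‖ ≤ w.re) :
    1 + w ^ 2 ∈ Complex.slitPlane := by
  rw [Complex.mem_slitPlane_iff]
  by_contra! h
  obtain ⟨h1, h2⟩ := h
  simp [pow_two] at h1 h2
  have h3 : w.re = 0 ∨ w.im = 0 := by
    have : w.re * w.im = 0 := by linarith
    exact mul_eq_zero.mp this
  rcases h3 with h3 | h3
  · rw [h3] at hw
    have h4 : ‖w‖ = 0 := le_antisymm (by nlinarith [norm_nonneg w]) (norm_nonneg w)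
    rw [norm_eq_zero.mp h4] at h1
    simp at h1
    linarith
  · rw [h3] at h1
    nlinarith [mul_self_nonneg w.re]

theorem sqrtOneAddSq_sq (w : ℂ) : sqrtOneAddSq w ^ 2 = 1 + w ^ 2 := by
  simp [sqrtOneAddSq]

theorem norm_sqrtOneAddSq_sq (w : ℂ) : ‖sqrtOneAddSq w‖ ^ 2 = ‖1 + w ^ 2‖ := by
  rw [← norm_pow, sqrtOneAddSq_sq]

theorem sqrtOneAddSq_re_pos (hc : 0 < c) (hw : c * ‖w‖ ≤ w.re) : 0 < (sqrtOneAddSq w).re := by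
  have hs := one_add_sq_mem_slitPlane hc hw
  have hne := Complex.slitPlane_ne_zero hs
  have harg := Complex.mem_slitPlane_iff_arg.mp hs
  rw [sqrtOneAddSq, Complex.cpow_def_of_ne_zero hne, Complex.exp_re]
  refine mul_pos (Real.exp_pos _) (Real.cos_pos_of_mem_Ioo ?_)
  have him : (Complex.log (1 + w ^ 2) * (1 / 2)).im = (1 + w ^ 2).arg / 2 := by
    rw [← Complex.log_im, show (1 / 2 : ℂ) = ((1 / 2 : ℝ) : ℂ) by norm_num,
      Complex.im_mul_ofReal]
    ring
  rw [him]
  have h1 := Complex.neg_pi_lt_arg (1 + w ^ 2)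
  have h2 := lt_of_le_of_ne (Complex.arg_le_pi (1 + w ^ 2)) harg.1
  constructor <;> linarith

theorem sqrtOneAddSq_ne_zero (hc : 0 < c) (hw : c * ‖w‖ ≤ w.re) : sqrtOneAddSq w ≠ 0 :=
  fun h => by simpa [h] using sqrtOneAddSq_re_pos hc hw

theorem add_sqrtOneAddSq_re_pos (hc : 0 < c) (hw : c * ‖w‖ ≤ w.re) :
    0 < (w + sqrtOneAddSq w).re := by
  rw [Complex.add_re]
  exact add_pos_of_nonneg_of_pos (re_nonneg_of_sector hc hw) (sqrtOneAddSq_re_pos hc hw)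

theorem add_sqrtOneAddSq_ne_zero (hc : 0 < c) (hw : c * ‖w‖ ≤ w.re) : w + sqrtOneAddSq w ≠ 0 :=
  fun h => by simpa [h] using add_sqrtOneAddSq_re_pos hc hw

theorem hasDerivAt_sqrtOneAddSq (hc : 0 < c) (hw : c * ‖w‖ ≤ w.re) :
    HasDerivAt sqrtOneAddSq (w / sqrtOneAddSq w) w := by
  have hs := one_add_sq_mem_slitPlane hc hw
  have h1 : HasDerivAt (fun w : ℂ => 1 + w ^ 2) (2 * w) w := by
    simpa using (hasDerivAt_pow 2 w).const_add 1
  have h2 := h1.cpow_const (c := (1 / 2 : ℂ)) hs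
  refine h2.congr_deriv ?_
  have hne := Complex.slitPlane_ne_zero hs
  have hS := sqrtOneAddSq_ne_zero hc hw
  rw [Complex.cpow_sub _ _ hne, Complex.cpow_one]
  change 1 / 2 * (sqrtOneAddSq w / (1 + w ^ 2)) * (2 * w) = _
  rw [← sqrtOneAddSq_sq]
  field_simp

theorem hasDerivAt_carcsinh (hc : 0 < c) (hw : c * ‖w‖ ≤ w.re) :
    HasDerivAt carcsinh (1 / sqrtOneAddSq w) w := by
  have h := ((hasDerivAt_id w).add (hasDerivAt_sqrtOneAddSq hc hw)).clog
    (Complex.mem_slitPlane_iff.mpr (Or.inl (add_sqrtOneAddSq_re_pos hc hw)))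
  refine h.congr_deriv ?_
  have hS := sqrtOneAddSq_ne_zero hc hw
  have hne := add_sqrtOneAddSq_ne_zero hc hw
  simp only [id, Pi.add_apply]
  field_simp
  ring

theorem exp_carcsinh (hc : 0 < c) (hw : c * ‖w‖ ≤ w.re) :
    Complex.exp (carcsinh w) = w + sqrtOneAddSq w := by
  rw [carcsinh_eq, Complex.exp_log (add_sqrtOneAddSq_ne_zero hc hw)]

theorem exp_neg_carcsinh (hc : 0 < c) (hw : c * ‖w‖ ≤ w.re) :
    Complex.exp (-carcsinh w) = sqrtOneAddSq w - w := by
  rw [Complex.exp_neg, exp_carcsinh hc hw]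
  refine inv_eq_of_mul_eq_one_right ?_
  linear_combination sqrtOneAddSq_sq w

theorem sinh_carcsinh (hc : 0 < c) (hw : c * ‖w‖ ≤ w.re) : Complex.sinh (carcsinh w) = w := by
  rw [Complex.sinh, exp_carcsinh hc hw, exp_neg_carcsinh hc hw]
  ring

/-- Writing `S = √(1 + w²)`, the imaginary part of `S² = 1 + w²` gives `Re S · Im S = Re w · Im w`,
so `Im S` and `Im w` do not have opposite signs. The cross term in `‖w + S‖²` is therefore
nonnegative. -/
theorem sq_norm_add_le_sq_norm_add_sqrtOneAddSq (hc : 0 < c) (hw : c * ‖w‖ ≤ w.re) :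
    ‖w‖ ^ 2 + ‖1 + w ^ 2‖ ≤ ‖w + sqrtOneAddSq w‖ ^ 2 := by
  rw [← norm_sqrtOneAddSq_sq]
  have hp := sqrtOneAddSq_re_pos hc hw
  have hre := re_nonneg_of_sector hc hw
  have him := congrArg Complex.im (sqrtOneAddSq_sq w)
  simp [pow_two] at him
  set S := sqrtOneAddSq w
  have h1 : S.re * S.im = w.re * w.im := by linarith
  have h2 : 0 ≤ w.im * S.im := by
    have h3 : 0 ≤ S.re * (w.im * S.im) := by
      have : S.re * (w.im * S.im) = w.re * w.im ^ 2 := by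
        linear_combination w.im * h1
      rw [this]
      positivity
    exact nonneg_of_mul_nonneg_right h3 hp
  rw [← Complex.normSq_eq_norm_sq, ← Complex.normSq_eq_norm_sq, ← Complex.normSq_eq_norm_sq,
    Complex.normSq_apply, Complex.normSq_apply, Complex.normSq_apply, Complex.add_re,
    Complex.add_im]
  nlinarith [mul_nonneg hre hp.le]

theorem carcsinh_re_nonneg (hc : 0 < c) (hw : c * ‖w‖ ≤ w.re) : 0 ≤ (carcsinh w).re := by
  rw [carcsinh_eq, Complex.log_re]
  refine Real.log_nonneg ?_
  have h1 := sq_norm_add_le_sq_norm_add_sqrtOneAddSq hc hw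
  have h2 : (1 : ℝ) ≤ ‖w‖ ^ 2 + ‖1 + w ^ 2‖ := by
    have := norm_sub_le (1 + w ^ 2) (w ^ 2)
    simp at this
    linarith
  nlinarith [norm_nonneg (w + sqrtOneAddSq w)]

theorem sector_smul (hw : c * ‖w‖ ≤ w.re) {t : ℝ} (ht : 0 ≤ t) :
    c * ‖(t : ℂ) * w‖ ≤ ((t : ℂ) * w).re := by
  rw [norm_mul, Complex.norm_real, Real.norm_of_nonneg ht, Complex.re_ofReal_mul]
  nlinarith

/-- Mean value inequality along the segment from `0` to `w`, which stays in the sector: there `|1 +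
t²w²| ≥ c`. -/
theorem norm_carcsinh_le (hc : 0 < c) (hc1 : c ≤ 1) (hw : c * ‖w‖ ≤ w.re) :
    ‖carcsinh w‖ ≤ ‖w‖ / Real.sqrt c := by
  have hd : ∀ t ∈ Set.Icc (0 : ℝ) 1, HasDerivWithinAt (fun t : ℝ => carcsinh (t * w))
      (1 / sqrtOneAddSq (t * w) * w) (Set.Icc 0 1) t := fun t ht => by
    have h1 : HasDerivAt (fun t : ℝ => (t : ℂ) * w) w t := by
      simpa using (Complex.ofRealCLM.hasDerivAt (x := t)).mul_const w
    exact ((hasDerivAt_carcsinh hc (sector_smul hw ht.1)).comp t h1).hasDerivWithinAt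
  have hbound : ∀ t ∈ Set.Ico (0 : ℝ) 1, ‖1 / sqrtOneAddSq (t * w) * w‖ ≤
      ‖w‖ / Real.sqrt c := fun t ht => by
    have hs := sector_smul hw ht.1
    have h1 := sector_le_norm_one_add_sq hc.le hc1 hs
    have h2 : Real.sqrt c ≤ ‖sqrtOneAddSq (t * w)‖ := by
      refine Real.sqrt_le_iff.mpr ⟨norm_nonneg _, ?_⟩
      rw [norm_sqrtOneAddSq_sq]
      nlinarith [sq_nonneg ‖(t : ℂ) * w‖]
    have h3 := Real.sqrt_pos.mpr hc
    rw [norm_mul, norm_div, norm_one, one_div, inv_mul_eq_div]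
    gcongr
  have h := norm_image_sub_le_of_norm_deriv_le_segment_01' hd hbound
  have h0 : carcsinh 0 = 0 := by simp [carcsinh]
  simpa [h0] using h

theorem norm_carcsinh_le_norm_one_add (hc : 0 < c) (hw : c * ‖w‖ ≤ w.re) :
    ‖carcsinh w‖ ≤ ‖1 + carcsinh w‖ ∧ 1 ≤ ‖1 + carcsinh w‖ := by
  have hre := carcsinh_re_nonneg hc hw
  constructor
  · refine le_of_sq_le_sq ?_ (norm_nonneg _)
    rw [← Complex.normSq_eq_norm_sq, ← Complex.normSq_eq_norm_sq, Complex.normSq_apply,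
      Complex.normSq_apply]
    simp
    nlinarith
  · have := Complex.re_le_norm (1 + carcsinh w)
    simp at this
    linarith

theorem abs_sinh_re_le_norm_sinh (z : ℂ) : |Real.sinh z.re| ≤ ‖Complex.sinh z‖ := by
  rw [Complex.sinh, norm_div, Complex.norm_ofNat, Real.sinh_eq, abs_div,
    abs_of_pos (two_pos : (0 : ℝ) < 2)]
  gcongr
  simpa [Complex.norm_exp] using abs_norm_sub_norm_le (Complex.exp z) (Complex.exp (-z))

theorem norm_cosh_le_cosh_re (z : ℂ) : ‖Complex.cosh z‖ ≤ Real.cosh z.re := by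
  rw [Complex.cosh, norm_div, Complex.norm_ofNat, Real.cosh_eq]
  gcongr
  simpa [Complex.norm_exp] using norm_add_le (Complex.exp z) (Complex.exp (-z))

/-- The mean value inequality on `[0, z]` gives the factor `cosh(Re z)`, and `cosh² = 1 + sinh²`
with `|sinh(Re z)| ≤ ‖sinh z‖` finishes. At `z = arcsinh w` it bounds `‖arcsinh w‖` from below. -/
theorem norm_sinh_le_sqrt_mul_norm (z : ℂ) :
    ‖Complex.sinh z‖ ≤ Real.sqrt (1 + ‖Complex.sinh z‖ ^ 2) * ‖z‖ := by
  have h1 : ‖Complex.sinh z‖ ≤ Real.cosh z.re * ‖z‖ := by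
    have hd : ∀ t ∈ Set.Icc (0 : ℝ) 1, HasDerivWithinAt (fun t : ℝ => Complex.sinh (t * z))
        (Complex.cosh (t * z) * z) (Set.Icc 0 1) t := fun t _ => by
      have h1 : HasDerivAt (fun t : ℝ => (t : ℂ) * z) z t := by
        simpa using (Complex.ofRealCLM.hasDerivAt (x := t)).mul_const z
      exact ((Complex.hasDerivAt_sinh _).comp t h1).hasDerivWithinAt
    have hbound : ∀ t ∈ Set.Ico (0 : ℝ) 1, ‖Complex.cosh (t * z) * z‖ ≤
        Real.cosh z.re * ‖z‖ := fun t ht => by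
      rw [norm_mul]
      gcongr
      refine (norm_cosh_le_cosh_re _).trans (Real.cosh_le_cosh.mpr ?_)
      rw [Complex.re_ofReal_mul, abs_mul, abs_of_nonneg ht.1]
      exact mul_le_of_le_one_left (abs_nonneg _) ht.2.le
    simpa using norm_image_sub_le_of_norm_deriv_le_segment_01' hd hbound
  refine h1.trans ?_
  gcongr
  refine Real.le_sqrt_of_sq_le ?_
  rw [Real.cosh_sq', ← sq_abs]
  gcongr
  exact abs_sinh_re_le_norm_sinh z

theorem norm_carcsinh_div_le (hc : 0 < c) (hc1 : c ≤ 1) (hw : c * ‖w‖ ≤ w.re) :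
    ‖carcsinh w / (1 + carcsinh w)‖ ≤ Real.sqrt (2 / c) * (‖w‖ / Real.sqrt (1 + ‖w‖ ^ 2)) := by
  obtain ⟨h1, h2⟩ := norm_carcsinh_le_norm_one_add hc hw
  have hsc := Real.sqrt_pos.mpr hc
  have hsc1 : Real.sqrt c ≤ 1 := Real.sqrt_le_one.mpr hc1
  have hs : 0 < Real.sqrt (1 + ‖w‖ ^ 2) := Real.sqrt_pos.mpr (by positivity)
  rw [norm_div, Real.sqrt_div two_pos.le, div_mul_div_comm]
  -- For small `w` the quotient is at most `‖arcsinh w‖ ≤ ‖w‖/√c`; for large `w` it is at most `1`,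
  -- while `‖w‖/√(1 + ‖w‖²) ≥ 1/√2`.
  rcases le_total ‖w‖ 1 with hr | hr
  · have h3 : Real.sqrt (1 + ‖w‖ ^ 2) ≤ Real.sqrt 2 := by
      refine Real.sqrt_le_sqrt ?_
      nlinarith [norm_nonneg w]
    calc ‖carcsinh w‖ / ‖1 + carcsinh w‖ ≤ ‖carcsinh w‖ := div_le_self (norm_nonneg _) h2
      _ ≤ ‖w‖ / Real.sqrt c := norm_carcsinh_le hc hc1 hw
      _ ≤ _ := by
        rw [div_le_div_iff₀ hsc (by positivity)]
        calc ‖w‖ * (Real.sqrt c * Real.sqrt (1 + ‖w‖ ^ 2)) ≤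
              ‖w‖ * (Real.sqrt c * Real.sqrt 2) := by gcongr
          _ = _ := by ring
  · calc ‖carcsinh w‖ / ‖1 + carcsinh w‖ ≤ 1 := div_le_one_of_le₀ h1 (norm_nonneg _)
      _ ≤ _ := by
        rw [one_le_div (by positivity)]
        have h3 : Real.sqrt (1 + ‖w‖ ^ 2) ≤ Real.sqrt 2 * ‖w‖ := by
          refine Real.sqrt_le_iff.mpr ⟨by positivity, ?_⟩
          rw [mul_pow, Real.sq_sqrt two_pos.le]
          nlinarith
        calc Real.sqrt c * Real.sqrt (1 + ‖w‖ ^ 2) ≤ 1 * (Real.sqrt 2 * ‖w‖) := by gcongr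
          _ = _ := one_mul _

/-- When `α < 1` the exponent `α - 1` is negative, so a lower bound on the base is what bounds the
power from above. -/
theorem le_norm_carcsinh_div (hc : 0 < c) (hw : c * ‖w‖ ≤ w.re) :
    1 / 2 * (‖w‖ / Real.sqrt (1 + ‖w‖ ^ 2)) ≤ ‖carcsinh w / (1 + carcsinh w)‖ := by
  obtain ⟨-, h2⟩ := norm_carcsinh_le_norm_one_add hc hw
  have hs : 0 < Real.sqrt (1 + ‖w‖ ^ 2) := Real.sqrt_pos.mpr (by positivity)
  have h3 := norm_sinh_le_sqrt_mul_norm (carcsinh w)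
  rw [sinh_carcsinh hc hw] at h3
  have h4 : ‖w‖ ≤ Real.sqrt (1 + ‖w‖ ^ 2) := Real.le_sqrt_of_sq_le (by linarith)
  rw [norm_div, div_mul_div_comm, one_mul, div_le_div_iff₀ (by positivity) (by linarith)]
  calc ‖w‖ * ‖1 + carcsinh w‖ ≤ ‖w‖ * (1 + ‖carcsinh w‖) := by
        gcongr
        simpa using norm_add_le 1 (carcsinh w)
    _ = ‖w‖ + ‖w‖ * ‖carcsinh w‖ := by ring
    _ ≤ Real.sqrt (1 + ‖w‖ ^ 2) * ‖carcsinh w‖ + Real.sqrt (1 + ‖w‖ ^ 2) * ‖carcsinh w‖ := by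
        gcongr
    _ = _ := by ring

/-- The norm equals `‖w + √(1 + w²)‖^(-β)`, and the squared base is at least `‖1 + w²‖ ≥ c(1 +
‖w‖²)`. -/
theorem norm_exp_neg_mul_carcsinh_le (hc : 0 < c) (hc1 : c ≤ 1) (hw : c * ‖w‖ ≤ w.re) {β : ℝ}
    (hβ : 0 < β) :
    ‖Complex.exp (-(β : ℂ) * carcsinh w)‖ ≤ 1 / (c * (1 + ‖w‖ ^ 2)) ^ (β / 2) := by
  have h1 := sector_le_norm_one_add_sq hc.le hc1 hw
  have h2 := sq_norm_add_le_sq_norm_add_sqrtOneAddSq hc hw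
  have h3 : c * (1 + ‖w‖ ^ 2) ≤ Real.exp (2 * (carcsinh w).re) := by
    have : Real.exp (2 * (carcsinh w).re) = ‖w + sqrtOneAddSq w‖ ^ 2 := by
      rw [← exp_carcsinh hc hw, Complex.norm_exp, ← Real.exp_nat_mul]
      norm_num
    rw [this]
    nlinarith [sq_nonneg ‖w‖]
  have h4 : (-(β : ℂ) * carcsinh w).re = -(β * (carcsinh w).re) := by simp
  rw [Complex.norm_exp, h4, Real.exp_neg, one_div]
  have h5 : Real.exp (β * (carcsinh w).re) = Real.exp (2 * (carcsinh w).re) ^ (β / 2) := by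
    rw [← Real.exp_mul]
    ring_nf
  rw [h5]
  gcongr

/-- The decay of `E₃` after the change of variables, in terms of a bound for its algebraic
factor. -/
theorem norm_E₃_mul_le (hw0 : w ≠ 0) (hc : 0 < c) (hc1 : c ≤ 1) (hw : c * ‖w‖ ≤ w.re) {α β T : ℝ}
    (hβ : 0 < β) (hT : 0 ≤ T)
    (hT' : ‖carcsinh w / (1 + carcsinh w)‖ ^ (α - 1) ≤
      T * (‖w‖ / Real.sqrt (1 + ‖w‖ ^ 2)) ^ (α - 1)) :
    ‖E₃ (carcsinh w) α β‖ * ‖w / sqrtOneAddSq w‖ ≤ T / c ^ ((β + 1) / 2) *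
      (‖w‖ ^ α / (1 + ‖w‖ ^ 2) ^ ((α + β) / 2)) := by
  have hr : 0 < ‖w‖ := norm_pos_iff.mpr hw0
  have hq : 0 < 1 + ‖w‖ ^ 2 := by positivity
  have h1 := sector_le_norm_one_add_sq hc.le hc1 hw
  have h2 := norm_exp_neg_mul_carcsinh_le hc hc1 hw hβ
  have h3 : ‖w / sqrtOneAddSq w‖ ≤ ‖w‖ / (c * (1 + ‖w‖ ^ 2)) ^ (1 / 2 : ℝ) := by
    rw [norm_div]
    gcongr
    rw [← Real.sqrt_eq_rpow]
    refine Real.sqrt_le_iff.mpr ⟨norm_nonneg _, ?_⟩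
    rwa [norm_sqrtOneAddSq_sq]
  rw [E₃, norm_mul, Complex.norm_cpow_real]
  calc _ ≤ (T * (‖w‖ / Real.sqrt (1 + ‖w‖ ^ 2)) ^ (α - 1)) *
        (1 / (c * (1 + ‖w‖ ^ 2)) ^ (β / 2)) * (‖w‖ / (c * (1 + ‖w‖ ^ 2)) ^ (1 / 2 : ℝ)) := by
        gcongr
    _ = _ := by
        rw [Real.sqrt_eq_rpow, Real.div_rpow hr.le (by positivity), ← Real.rpow_mul hq.le,
          Real.rpow_sub_one hr.ne', Real.mul_rpow hc.le hq.le, Real.mul_rpow hc.le hq.le,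
          show (α + β) / 2 = 1 / 2 * (α - 1) + β / 2 + 1 / 2 by ring,
          show (β + 1) / 2 = β / 2 + 1 / 2 by ring, Real.rpow_add hq, Real.rpow_add hq,
          Real.rpow_add hc]
        field_simp

theorem norm_carcsinh_div_rpow_le_of_lt_one (hw0 : w ≠ 0) (hc : 0 < c) (hw : c * ‖w‖ ≤ w.re)
    {α : ℝ} (hα : α < 1) :
    ‖carcsinh w / (1 + carcsinh w)‖ ^ (α - 1) ≤
      2 ^ (1 - α) * (‖w‖ / Real.sqrt (1 + ‖w‖ ^ 2)) ^ (α - 1) := by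
  have hr : 0 < ‖w‖ := norm_pos_iff.mpr hw0
  have h := le_norm_carcsinh_div hc hw
  calc _ ≤ (1 / 2 * (‖w‖ / Real.sqrt (1 + ‖w‖ ^ 2))) ^ (α - 1) :=
        Real.rpow_le_rpow_of_nonpos (by positivity) h (by linarith)
    _ = _ := by
        rw [Real.mul_rpow (by positivity) (by positivity), one_div, Real.inv_rpow two_pos.le,
          ← Real.rpow_neg two_pos.le, neg_sub]

theorem norm_carcsinh_div_rpow_le_of_one_le (hc : 0 < c) (hc1 : c ≤ 1) (hw : c * ‖w‖ ≤ w.re)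
    {α : ℝ} (hα : 1 ≤ α) :
    ‖carcsinh w / (1 + carcsinh w)‖ ^ (α - 1) ≤
      (2 / c) ^ ((α - 1) / 2) * (‖w‖ / Real.sqrt (1 + ‖w‖ ^ 2)) ^ (α - 1) := by
  have h := norm_carcsinh_div_le hc hc1 hw
  calc _ ≤ (Real.sqrt (2 / c) * (‖w‖ / Real.sqrt (1 + ‖w‖ ^ 2))) ^ (α - 1) :=
        Real.rpow_le_rpow (norm_nonneg _) h (by linarith)
    _ = _ := by
        rw [Real.mul_rpow (by positivity) (by positivity), Real.sqrt_eq_rpow,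
          ← Real.rpow_mul (by positivity)]
        ring_nf

end Sector

/-! ### Case 3: constants and conclusion -/

theorem sqrtOneAddSq_ofReal (r : ℝ) : sqrtOneAddSq r = (Real.sqrt (1 + r ^ 2) : ℂ) := by
  rw [sqrtOneAddSq, Real.sqrt_eq_rpow, Complex.ofReal_cpow (by positivity)]
  push_cast
  rfl

theorem hasDerivAt_seMap₃ {d : ℝ} (hd : 0 < d) (hd' : d < Real.pi / 2) {ζ : ℂ}
    (hζ : ζ ∈ strip d) :
    HasDerivAt seMap₃ (Complex.exp ζ / sqrtOneAddSq (Complex.exp ζ)) ζ := by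
  have hcos : 0 < Real.cos d := Real.cos_pos_of_mem_Ioo ⟨by linarith, hd'⟩
  refine ((hasDerivAt_carcsinh hcos (cos_mul_norm_exp_le hd' hζ)).comp ζ
    (Complex.hasDerivAt_exp ζ)).congr_deriv ?_
  ring

/-- Equivalent to `1 + 2z ≤ exp(2z)`. On the real line it improves the sector factor `2^((α-1)/2)`
to `1` when `α ≥ 1`. -/
theorem div_one_add_le_sinh_div_cosh {z : ℝ} (hz : 0 ≤ z) :
    z / (1 + z) ≤ Real.sinh z / Real.cosh z := by
  have h1 : Real.exp z = Real.exp (-z) * Real.exp (2 * z) := by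
    rw [← Real.exp_add]; ring_nf
  have h2 : Real.exp (-z) * (2 * z + 1) ≤ Real.exp z := by
    rw [h1]
    gcongr
    exact Real.add_one_le_exp _
  rw [div_le_div_iff₀ (by linarith) (Real.cosh_pos z), Real.sinh_eq, Real.cosh_eq]
  nlinarith

theorem norm_arsinh_div_rpow_le (x : ℝ) {α : ℝ} (hα : 1 ≤ α) :
    ‖carcsinh (Real.exp x : ℝ) / (1 + carcsinh (Real.exp x : ℝ))‖ ^ (α - 1) ≤
      1 * (‖((Real.exp x : ℝ) : ℂ)‖ / Real.sqrt (1 + ‖((Real.exp x : ℝ) : ℂ)‖ ^ 2)) ^ (α - 1) := by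
  have hz : 0 ≤ Real.arsinh (Real.exp x) := Real.arsinh_nonneg_iff.mpr (Real.exp_pos x).le
  have h := div_one_add_le_sinh_div_cosh hz
  rw [Real.sinh_arsinh, Real.cosh_arsinh] at h
  rw [one_mul, carcsinh_ofReal, Complex.norm_real, Real.norm_of_nonneg (Real.exp_pos x).le]
  have e : (Real.arsinh (Real.exp x) : ℂ) / (1 + Real.arsinh (Real.exp x)) =
      ((Real.arsinh (Real.exp x) / (1 + Real.arsinh (Real.exp x)) : ℝ) : ℂ) := by push_cast; rfl
  rw [e, Complex.norm_real, Real.norm_of_nonneg (by positivity)]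
  exact Real.rpow_le_rpow (by positivity) h (by linarith)

theorem norm_comp_carcsinh_mul_le {f : ℂ → ℂ} {K α β c T : ℝ} {w : ℂ} (hw0 : w ≠ 0) (hK : 0 < K)
    (hβ : 0 < β) (hc : 0 < c) (hc1 : c ≤ 1) (hw : c * ‖w‖ ≤ w.re) (hT : 0 ≤ T)
    (hT' : ‖carcsinh w / (1 + carcsinh w)‖ ^ (α - 1) ≤
      T * (‖w‖ / Real.sqrt (1 + ‖w‖ ^ 2)) ^ (α - 1))
    (hf : ‖f (carcsinh w)‖ ≤ K * ‖E₃ (carcsinh w) α β‖) :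
    ‖f (carcsinh w) * (w / sqrtOneAddSq w)‖ ≤ K * (T / c ^ ((β + 1) / 2)) *
      (‖w‖ ^ α / (1 + ‖w‖ ^ 2) ^ ((α + β) / 2)) := by
  have h := norm_E₃_mul_le hw0 hc hc1 hw hβ hT hT'
  rw [norm_mul]
  calc _ ≤ K * ‖E₃ (carcsinh w) α β‖ * ‖w / sqrtOneAddSq w‖ := by gcongr
    _ = K * (‖E₃ (carcsinh w) α β‖ * ‖w / sqrtOneAddSq w‖) := by ring
    _ ≤ K * _ := mul_le_mul_of_nonneg_left h hK.le
    _ = _ := by ring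

theorem constc_nonneg {α d : ℝ} (hcos : 0 < Real.cos d) : 0 ≤ constc α d := by
  unfold constc
  split_ifs <;> positivity

/-- The factors found here are `2^(1-α)` for `α < 1` and `(2/cos d)^((α-1)/2)` otherwise; both fit
under the stated constant, whose factor `2^(1+β/2)` leaves room. -/
theorem exists_norm_carcsinh_div_rpow_le {α β d : ℝ} (hα0 : 0 < α) (hβ : 0 < β) (hcos : 0 < Real.cos d) :
    ∃ T : ℝ, 0 ≤ T ∧ T / Real.cos d ^ ((β + 1) / 2) ≤
      2 ^ (1 + β / 2) * constc α d / Real.cos d ^ ((α + β) / 2) ∧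
      ∀ w : ℂ, w ≠ 0 → Real.cos d * ‖w‖ ≤ w.re →
        ‖carcsinh w / (1 + carcsinh w)‖ ^ (α - 1) ≤
          T * (‖w‖ / Real.sqrt (1 + ‖w‖ ^ 2)) ^ (α - 1) := by
  have hc1 := Real.cos_le_one d
  set c := Real.cos d with hc
  have h2β : (2 : ℝ) ≤ 2 ^ (1 + β / 2) := by
    calc (2 : ℝ) = 2 ^ (1 : ℝ) := (Real.rpow_one 2).symm
      _ ≤ _ := Real.rpow_le_rpow_of_exponent_le one_le_two (by linarith)
  unfold constc
  rw [← hc]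
  rcases lt_or_ge α 1 with hα | hα
  · refine ⟨2 ^ (1 - α), by positivity, ?_,
      fun w hw0 hw => norm_carcsinh_div_rpow_le_of_lt_one hw0 hcos hw hα⟩
    rw [if_pos hα]
    have h1 : (2 : ℝ) ^ (1 - α) = 2 ^ ((1 - α) / 2) * 2 ^ ((1 - α) / 2) := by
      rw [← Real.rpow_add two_pos]; ring_nf
    -- The powers of `c` differ by `c^((1-α)/2)`, which `constc` compensates because `2(1 + 1/c)c =
    -- 2(c + 1) ≥ 2`.
    have h2 : (2 : ℝ) ^ ((1 - α) / 2) * c ^ ((α + β) / 2) ≤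
        (2 * (1 + 1 / c)) ^ ((1 - α) / 2) * c ^ ((β + 1) / 2) := by
      rw [show (β + 1) / 2 = (1 - α) / 2 + (α + β) / 2 by ring, Real.rpow_add hcos, ← mul_assoc,
        ← Real.mul_rpow (by positivity) hcos.le]
      gcongr
      have : 2 * (1 + 1 / c) * c = 2 * (c + 1) := by field_simp
      linarith
    rw [div_le_div_iff₀ (by positivity) (by positivity), h1]
    calc _ = (2 : ℝ) ^ ((1 - α) / 2) * ((2 : ℝ) ^ ((1 - α) / 2) * c ^ ((α + β) / 2)) := by ring
      _ ≤ 2 ^ (1 + β / 2) * ((2 * (1 + 1 / c)) ^ ((1 - α) / 2) * c ^ ((β + 1) / 2)) := by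
        gcongr
        · exact one_le_two
        · linarith
      _ = _ := by ring
  · refine ⟨(2 / c) ^ ((α - 1) / 2), by positivity, ?_,
      fun w _ hw => norm_carcsinh_div_rpow_le_of_one_le hcos hc1 hw hα⟩
    rw [if_neg hα.not_gt, Real.div_rpow two_pos.le hcos.le, div_div, ← Real.rpow_add hcos,
      show (α - 1) / 2 + (β + 1) / 2 = (α + β) / 2 by ring]
    gcongr
    exact le_mul_of_one_le_left (by positivity) (by linarith)

theorem sincIndef_seMap₃_error_le {f : ℂ → ℂ} {d K α β : ℝ} {n : ℕ}
    (hd : 0 < d) (hd' : d < Real.pi / 2) (hK : 0 < K) (hα : 0 < α) (hβ : 0 < β) (hn : 0 < n)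
    (hf : AnalyticOnNhd ℂ f (seMap₃ '' strip d))
    (hb : ∀ z ∈ seMap₃ '' strip d, ‖f z‖ ≤ K * ‖E₃ z α β‖) {τ : ℝ} (hτ : 0 < τ) :
    IntervalIntegrable (fun t : ℝ => f (t : ℂ)) volume 0 τ ∧
    ‖(∫ t in (0 : ℝ)..τ, f (t : ℂ)) - sincIndef seMap₃ f d α β n (seInv₃ τ)‖ ≤
      constC₃ K d α β * Real.exp (-Real.sqrt (Real.pi * d * min α β * n)) := by
  have hcos : 0 < Real.cos d := Real.cos_pos_of_mem_Ioo ⟨by linarith, hd'⟩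
  have hderiv : ∀ ζ ∈ strip d,
      deriv seMap₃ ζ = Complex.exp ζ / sqrtOneAddSq (Complex.exp ζ) := fun ζ hζ =>
    (hasDerivAt_seMap₃ hd hd' hζ).deriv
  have hmem : ∀ x : ℝ, (x : ℂ) ∈ strip d := fun x => by simpa [strip] using hd
  set p : ℝ → ℝ := fun x => Real.arsinh (Real.exp x) with hp
  set p' : ℝ → ℝ := fun x => Real.exp x / Real.sqrt (1 + Real.exp x ^ 2) with hp'
  -- The exponent is `max(1 - α, 0)`: the factor is `2^(1-α)` for `α < 1` and `1` otherwise.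
  set T₀ : ℝ := 2 ^ ((1 - α + |1 - α|) / 2) with hT₀
  have hreal : ∀ x : ℝ, ‖f (p x) * p' x‖ ≤ K * T₀ *
      (Real.exp x ^ α / (1 + Real.exp x ^ 2) ^ ((α + β) / 2)) := fun x => by
    have hw0 : ((Real.exp x : ℝ) : ℂ) ≠ 0 := by exact_mod_cast (Real.exp_pos x).ne'
    have hn : ‖((Real.exp x : ℝ) : ℂ)‖ = Real.exp x := by
      rw [Complex.norm_real, Real.norm_of_nonneg (Real.exp_pos x).le]
    have hw : 1 * ‖((Real.exp x : ℝ) : ℂ)‖ ≤ ((Real.exp x : ℝ) : ℂ).re := by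
      rw [hn, one_mul, Complex.ofReal_re]
    have hT : ‖carcsinh (Real.exp x : ℝ) / (1 + carcsinh (Real.exp x : ℝ))‖ ^ (α - 1) ≤
        T₀ * (‖((Real.exp x : ℝ) : ℂ)‖ / Real.sqrt (1 + ‖((Real.exp x : ℝ) : ℂ)‖ ^ 2)) ^
          (α - 1) := by
      rcases lt_or_ge α 1 with h1 | h1
      · have : T₀ = 2 ^ (1 - α) := by
          rw [hT₀, abs_of_pos (by linarith)]
          ring_nf
        rw [this]
        exact norm_carcsinh_div_rpow_le_of_lt_one hw0 one_pos hw h1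
      · have : T₀ = 1 := by
          rw [hT₀, abs_of_nonpos (by linarith)]
          simp
        rw [this]
        exact norm_arsinh_div_rpow_le x h1
    have hfx := hb _ ⟨x, hmem x, rfl⟩
    rw [seMap₃, ← Complex.ofReal_exp] at hfx
    have := norm_comp_carcsinh_mul_le hw0 hK hβ one_pos le_rfl hw (by positivity) hT hfx
    rw [hn, Real.one_rpow, div_one, carcsinh_ofReal, sqrtOneAddSq_ofReal,
      ← Complex.ofReal_div] at this
    exact this
  obtain ⟨T, hT0, hTle, hT⟩ := exists_norm_carcsinh_div_rpow_le hα hβ hcos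
  have himage : p '' Set.Iic (seInv₃ τ) = Set.Ioc 0 τ := by
    ext t
    constructor
    · rintro ⟨x, hx, rfl⟩
      refine ⟨Real.arsinh_pos_iff.mpr (Real.exp_pos x), ?_⟩
      rw [← Real.arsinh_sinh τ]
      exact Real.arsinh_le_arsinh.mpr
        ((Real.le_log_iff_exp_le (Real.sinh_pos_iff.mpr hτ)).mp hx)
    · rintro ⟨h0, h1⟩
      have hs := Real.sinh_pos_iff.mpr h0
      refine ⟨Real.log (Real.sinh t), Real.log_le_log hs (Real.sinh_le_sinh.mpr h1), ?_⟩
      simp only [hp]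
      rw [Real.exp_log hs, Real.arsinh_sinh]
  have hmono : Monotone p := fun x y hxy =>
    Real.arsinh_le_arsinh.mpr (Real.exp_le_exp.mpr hxy)
  have hpd : ∀ x, HasDerivAt p (p' x) x := fun x => by
    refine ((Real.hasDerivAt_arsinh _).comp x (Real.hasDerivAt_exp x)).congr_deriv ?_
    rw [inv_mul_eq_div]
  have hK' : 0 ≤ K * T₀ := by positivity
  have hmain := sincIndef_error_le (n := n) hd hα hβ hn (ψ := seMap₃) (f := f) (p := p)
    (p' := p') (fun ζ hζ => (hasDerivAt_seMap₃ hd hd' hζ).differentiableAt.differentiableWithinAt)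
    hf seMap₃_ofReal
    (fun x => by
      rw [hderiv _ (hmem x), ← Complex.ofReal_exp, sqrtOneAddSq_ofReal, ← Complex.ofReal_div])
    hpd hmono hτ.le himage
    (B := K * (2 ^ (1 + β / 2) * constc α d / Real.cos d ^ ((α + β) / 2))) (B₀ := K * T₀)
    (fun ζ hζ => by
      rw [hderiv ζ hζ]
      have hsec := cos_mul_norm_exp_le hd' hζ
      have hw0 := Complex.exp_ne_zero ζ
      have h := norm_comp_carcsinh_mul_le hw0 hK hβ hcos (Real.cos_le_one d) hsec hT0
        (hT _ hw0 hsec) (hb _ ⟨ζ, hζ, rfl⟩)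
      rw [Complex.norm_exp] at h
      refine h.trans (mul_le_mul (mul_le_mul_of_nonneg_left hTle hK.le)
        (exp_rpow_div_le_exp_neg_min _ hα hβ) (by positivity) ?_)
      have := constc_nonneg (α := α) hcos
      positivity)
    (fun x => (hreal x).trans (mul_le_mul_of_nonneg_left (exp_rpow_div_le x hα hβ).1 hK'))
    (fun x => (hreal x).trans (mul_le_mul_of_nonneg_left (exp_rpow_div_le x hα hβ).2 hK'))
  refine ⟨hmain.1, hmain.2.trans (le_of_eq ?_)⟩
  rw [constC₃, ← hT₀]
  congr 1
  rw [mul_comm (1 - Real.exp _)]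
  simp only [div_eq_mul_inv, mul_inv]
  ring

end

theorem theorem3p2 (f : ℂ → ℂ) (d K α β : ℝ) (n : ℕ)
    (hd : 0 < d) (hd' : d < Real.pi / 2) (hK : 0 < K) (hα : 0 < α) (hβ : 0 < β) (hn : 0 < n) :
    ((AnalyticOnNhd ℂ f (seMap₂ '' strip d) →
      (∀ z ∈ seMap₂ '' strip d, ‖f z‖ ≤ K * ‖E₂ z α β‖) →
      ∀ τ ∈ Set.Ioi (0 : ℝ),
        IntervalIntegrable (fun t : ℝ => f (t : ℂ)) volume 0 τ ∧
        ‖(∫ t in (0 : ℝ)..τ, f (t : ℂ)) - sincIndef seMap₂ f d α β n (seInv₂ τ)‖ ≤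
          constC₂ K d α β * Real.exp (-Real.sqrt (Real.pi * d * min α β * n)))) ∧
    ((AnalyticOnNhd ℂ f (seMap₃ '' strip d) →
      (∀ z ∈ seMap₃ '' strip d, ‖f z‖ ≤ K * ‖E₃ z α β‖) →
      ∀ τ ∈ Set.Ioi (0 : ℝ),
        IntervalIntegrable (fun t : ℝ => f (t : ℂ)) volume 0 τ ∧
        ‖(∫ t in (0 : ℝ)..τ, f (t : ℂ)) - sincIndef seMap₃ f d α β n (seInv₃ τ)‖ ≤
          constC₃ K d α β * Real.exp (-Real.sqrt (Real.pi * d * min α β * n)))) := by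
  exact ⟨fun hf hb _ hτ => sincIndef_seMap₂_error_le hd hd' hK hα hβ hn hf hb hτ,
    fun hf hb _ hτ => sincIndef_seMap₃_error_le hd hd' hK hα hβ hn hf hb hτ⟩
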